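/- Let $M$ be a smooth oriented Riemannian manifold (without boundary) of dimension $3$, with Levi-Civita connection $\nabla$, Hodge star $*$ (determined by $\beta\wedge *\gamma=\langle\beta,\gamma\rangle\,\mathrm{vol}$), codifferential $d^{*}=(-1)^{3(r+1)+1}*d*$ on $r$-forms (the formal $L^2$-adjoint of the exterior derivative $d$), and De Rham–Hodge Laplacian $\square=dd^{*}+d^{*}d$. For a vector field $A$, let $\tilde A=\langle A,\cdot\rangle$ be the dual $1$-form, let $\square A$ be the vector field dual to $\square\tilde A$, let $\operatorname{div}A=\operatorname{Trace}(\nabla A)$, and let $\nabla^{s}A$ be the symmetric part of $\nabla A$, i.e. the $(1,1)$-tensor with $$\langle \nabla^{s}_XA,Y\rangle=\tfrac12\bigl(\langle\nabla_XA,Y\rangle+\langle\nabla_YA,X\rangle\bigr).$$ For a $p$-form $\beta$ and a $(1,1)$-tensor $T$ put $(\beta\odot T)(X_1,\dots,X_p)=\sum_{i=1}^{p}\beta(X_1,\dots,T(X_i),\dots,X_p)$. Let $\nu\in\mathbb R$, let $J\subset\mathbb R$ be an interval with more than one point (for instance $[0,T]$ or $[0,\infty)$), and let $(u_t,p_t)_{t\in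 J}$ be a smooth solution on $M$ of the Navier–Stokes equation $$\partial_tu_t+\nabla_{u_t}u_t+\nu\,\square u_t=-\nabla p_t,\qquad \operatorname{div}(u_t)=0,$$ that is, $u$ is smooth jointly in $(t,x)\in J\times M$ and each $p_t$ is a smooth function on $M$. Then the vorticity $\omega_t=*\,d\tilde u_t$, a $1$-form on $M$, is differentiable in $t$ at each point of $M$ and satisfies, for all $t\in J$ and at every point of $M$, $$\partial_t\omega_t+\nabla_{u_t}\omega_t+\nu\,\square\omega_t=\omega_t\odot\nabla^{s}u_t .$$ (At end points of $J$, $\partial_t$ is the one-sided derivative.) -/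

import Mathlib

open Bundle Module
open scoped Manifold ContDiff Topology

namespace NSVorticity

noncomputable section

/-! ### Exterior algebra of a single (tangent) space -/

section LinearAlgebra

/-- The operation `β ⊙ T` of an endomorphism `T` on a `p`-form `β`:
`(β ⊙ T)(X₁, …, X_p) = ∑ᵢ β(X₁, …, T Xᵢ, …, X_p)`. -/
def insertEndo {V : Type*} [AddCommGroup V] [Module ℝ V] [TopologicalSpace V] {p : ℕ}
    (β : V [⋀^Fin p]→L[ℝ] ℝ) (T : V →L[ℝ] V) : V [⋀^Fin p]→L[ℝ] ℝ where
  toFun X := ∑ i, β (Function.update X i (T (X i)))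
  map_update_add' := by
    intro inst X j a b
    rw [← Finset.sum_add_distrib]
    refine Finset.sum_congr rfl fun i _ => ?_
    have hinst : inst = instDecidableEqFin p := Subsingleton.elim _ _
    subst hinst
    by_cases h : i = j
    · subst h; simp
    · have h' : j ≠ i := fun e => h e.symm
      simp [Function.update_of_ne h, Function.update_comm h']
  map_update_smul' := by
    intro inst X j c a
    rw [Finset.smul_sum]
    refine Finset.sum_congr rfl fun i _ => ?_
    have hinst : inst = instDecidableEqFin p := Subsingleton.elim _ _
    subst hinst
    by_cases h : i = j
    · subst h; simp
    · have h' : j ≠ i := fun e => h e.symm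
      simp [Function.update_of_ne h, Function.update_comm h']
  map_eq_zero_of_eq' := by
    intro X j k hX hjk
    have hz : ∀ i, i ≠ j → i ≠ k → β (Function.update X i (T (X i))) = 0 := by
      intro i hij hik
      refine β.map_eq_zero_of_eq _ (i := j) (j := k) ?_ hjk
      simp [Function.update_of_ne (Ne.symm hij), Function.update_of_ne (Ne.symm hik), hX]
    have hsum : ∑ i, β (Function.update X i (T (X i)))
        = β (Function.update X j (T (X j))) + β (Function.update X k (T (X k))) :=
      Fintype.sum_eq_add j k hjk fun i hi => hz i hi.1 hi.2
    have hsw : Function.update X k (T (X k))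
        = Function.update X j (T (X j)) ∘ Equiv.swap j k := by
      funext i
      by_cases h1 : i = j
      · subst h1
        simp [Function.update_of_ne hjk, Function.update_of_ne hjk.symm, hX]
      · by_cases h2 : i = k
        · subst h2; simp [hX]
        · simp [Equiv.swap_apply_of_ne_of_ne h1 h2, Function.update_of_ne h1,
            Function.update_of_ne h2]
    change ∑ i, β (Function.update X i (T (X i))) = 0
    rw [hsum, hsw]
    have := β.toAlternatingMap.map_swap (Function.update X j (T (X j))) hjk
    have h3 : β (Function.update X j (T (X j)) ∘ Equiv.swap j k)
        = - β (Function.update X j (T (X j))) := this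
    rw [h3]; ring
  cont := by
    change Continuous fun X : Fin p → V => ∑ i, β (Function.update X i (T (X i)))
    refine continuous_finsetSum _ fun i _ => ?_
    exact β.cont.comp (continuous_id.update i (T.continuous.comp (continuous_apply i)))

variable {V : Type*} [NormedAddCommGroup V] [InnerProductSpace ℝ V]

/-- The interior product of the volume form with the vectors `a₁, …, a_p`:
`(v₁, …, v_q) ↦ vol(a₁, …, a_p, v₁, …, v_q)`. -/
def contractVol {n p q : ℕ} [Fact (finrank ℝ V = n)] (o : Orientation ℝ V (Fin n))
    (h : p + q = n) (a : Fin p → V) : V [⋀^Fin q]→L[ℝ] ℝ :=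
  AlternatingMap.mkContinuous
    { toFun := fun v => o.volumeForm (Fin.append a v ∘ Fin.cast h.symm)
      map_update_add' := by
        intro inst v j x y
        subst h
        have hinst : inst = instDecidableEqFin q := Subsingleton.elim _ _
        subst hinst
        have key : ∀ z, Fin.append a (Function.update v j z) ∘ Fin.cast rfl
            = Function.update (Fin.append a v) (Fin.natAdd p j) z := by
          intro z; funext i
          refine Fin.addCases (fun k => ?_) (fun k => ?_) i
          · have : Fin.castAdd q k ≠ Fin.natAdd p j := by
              intro e; have := congrArg Fin.val e; simp at this; omega
            simp [Function.update_of_ne this]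
          · by_cases hk : k = j
            · subst hk; simp
            · have : Fin.natAdd p k ≠ Fin.natAdd p j := by
                intro e; exact hk (by simpa using e)
              simp [Function.update_of_ne this, Function.update_of_ne hk]
        rw [key, key, key]; exact AlternatingMap.map_update_add _ _ _ _ _
      map_update_smul' := by
        intro inst v j c x
        subst h
        have hinst : inst = instDecidableEqFin q := Subsingleton.elim _ _
        subst hinst
        have key : ∀ z, Fin.append a (Function.update v j z) ∘ Fin.cast rfl
            = Function.update (Fin.append a v) (Fin.natAdd p j) z := by
          intro z; funext i
          refine Fin.addCases (fun k => ?_) (fun k => ?_) i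
          · have : Fin.castAdd q k ≠ Fin.natAdd p j := by
              intro e; have := congrArg Fin.val e; simp at this; omega
            simp [Function.update_of_ne this]
          · by_cases hk : k = j
            · subst hk; simp
            · have : Fin.natAdd p k ≠ Fin.natAdd p j := by
                intro e; exact hk (by simpa using e)
              simp [Function.update_of_ne this, Function.update_of_ne hk]
        rw [key, key]; exact AlternatingMap.map_update_smul _ _ _ _ _
      map_eq_zero_of_eq' := by
        intro v i j hv hij
        subst h
        refine AlternatingMap.map_eq_zero_of_eq _ _ (i := Fin.natAdd p i) (j := Fin.natAdd p j)
          ?_ ?_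
        · simpa using hv
        · intro e; exact hij (by simpa using e) }
    (∏ i, ‖a i‖) (by
      intro v
      subst h
      have := o.abs_volumeForm_apply_le (Fin.append a v ∘ Fin.cast rfl)
      simpa [Fin.prod_univ_add] using this)

/-- The Hodge star `∗ : Λᵖ → Λ^q`, `p + q = n`, of an oriented Euclidean space of dimension `n`:
with respect to an orthonormal basis `e₁, …, e_n`,
`∗β = ∑_{i₁ < ⋯ < i_p} β(e_{i₁}, …, e_{i_p}) vol(e_{i₁}, …, e_{i_p}, ⬝)`. The sum below runs over all
`p`-tuples of indices and is divided by `p!` accordingly. It does not depend on the orthonormal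
basis, and it is the map determined by `β ∧ ∗γ = ⟨β, γ⟩ vol`. -/
def hodgeStar {n p q : ℕ} [Fact (finrank ℝ V = n)] [FiniteDimensional ℝ V]
    (o : Orientation ℝ V (Fin n)) (h : p + q = n)
    (β : V [⋀^Fin p]→L[ℝ] ℝ) : V [⋀^Fin q]→L[ℝ] ℝ :=
  ((p.factorial : ℝ)⁻¹) • ∑ f : Fin p → Fin (finrank ℝ V),
    β (fun i => stdOrthonormalBasis ℝ V (f i)) •
      contractVol o h (fun i => stdOrthonormalBasis ℝ V (f i))

/-- The vector `α^♯` dual to a covector `α`: `⟨α^♯, v⟩ = α v`. -/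
def sharp [FiniteDimensional ℝ V] (α : V →L[ℝ] ℝ) : V :=
  haveI : CompleteSpace V := FiniteDimensional.complete ℝ V
  (InnerProductSpace.toDual ℝ V).symm α

/-- `sharp` as a continuous linear map. -/
def sharpL [FiniteDimensional ℝ V] : (V →L[ℝ] ℝ) →L[ℝ] V :=
  LinearMap.toContinuousLinearMap
    { toFun := sharp
      map_add' := fun α β => by simp [sharp]
      map_smul' := fun c α => by simp [sharp] }

/-- The symmetric part of an endomorphism:
`⟨T^s X, Y⟩ = (⟨T X, Y⟩ + ⟨T Y, X⟩) / 2`. -/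
def symPart [FiniteDimensional ℝ V] (T : V →L[ℝ] V) : V →L[ℝ] V :=
  haveI : CompleteSpace V := FiniteDimensional.complete ℝ V
  (2⁻¹ : ℝ) • (T + ContinuousLinearMap.adjoint T)

/-- The Christoffel symbols of the first kind at `z` of a metric `g` on a vector space, with the
argument `b` fixed: `(a, c) ↦ (D_a g(b, c) + D_b g(a, c) - D_c g(b, a)) / 2`. -/
def christoffelForm {F : Type*} [NormedAddCommGroup F] [NormedSpace ℝ F]
    (g : F → F →L[ℝ] F →L[ℝ] ℝ) (z b : F) : F →L[ℝ] F →L[ℝ] ℝ :=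
  (2⁻¹ : ℝ) • ((fderiv ℝ g z).flip b + fderiv ℝ g z b - ((fderiv ℝ g z).flip b).flip)

end LinearAlgebra

/-! ### Calculus on a Riemannian manifold, through charts

`M` is a manifold modelled on `ℝⁿ`. At each point `x` all objects are computed in the preferred
chart `φ = extChartAt (𝓡 n) x` around `x`. -/

section Manifold

variable {n : ℕ} {M : Type*} [TopologicalSpace M] [ChartedSpace (EuclideanSpace ℝ (Fin n)) M]

/-- The model space `ℝⁿ`. -/
abbrev Model (n : ℕ) : Type := EuclideanSpace ℝ (Fin n)

/-- Vector fields. -/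
abbrev VField (n : ℕ) (M : Type*) [TopologicalSpace M] [ChartedSpace (Model n) M] : Type _ :=
  (x : M) → TangentSpace (𝓡 n) x

/-- Differential `p`-forms. -/
abbrev DForm (n : ℕ) (M : Type*) [TopologicalSpace M] [ChartedSpace (Model n) M] (p : ℕ) :
    Type _ :=
  (x : M) → TangentSpace (𝓡 n) x [⋀^Fin p]→L[ℝ] ℝ

instance (x : M) : FiniteDimensional ℝ (TangentSpace (𝓡 n) x) :=
  inferInstanceAs (FiniteDimensional ℝ (EuclideanSpace ℝ (Fin n)))

instance (x : M) : Fact (finrank ℝ (TangentSpace (𝓡 n) x) = n) :=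
  ⟨(finrank_euclideanSpace_fin : finrank ℝ (EuclideanSpace ℝ (Fin n)) = n)⟩

/-- The differential `dφ_y : T_y M → ℝⁿ` of the chart `φ` around `x`. -/
def toModel (x y : M) : TangentSpace (𝓡 n) y →L[ℝ] Model n :=
  mfderiv (𝓡 n) 𝓘(ℝ, Model n) (extChartAt (𝓡 n) x) y

/-- The differential of `φ⁻¹` at the point `z ∈ ℝⁿ`, where `φ` is the chart around `x`. -/
def ofModel (x : M) (z : Model n) :
    Model n →L[ℝ] TangentSpace (𝓡 n) ((extChartAt (𝓡 n) x).symm z) :=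
  mfderiv 𝓘(ℝ, Model n) (𝓡 n) (extChartAt (𝓡 n) x).symm z

/-- A `p`-form in the chart around `x`. -/
def formInChart {p : ℕ} (α : DForm n M p) (x : M) (z : Model n) : Model n [⋀^Fin p]→L[ℝ] ℝ :=
  (α ((extChartAt (𝓡 n) x).symm z)).compContinuousLinearMap (ofModel x z)

/-- A vector field in the chart around `x`. -/
def fieldInChart (Y : VField n M) (x : M) (z : Model n) : Model n :=
  toModel x ((extChartAt (𝓡 n) x).symm z) (Y ((extChartAt (𝓡 n) x).symm z))

/-- The exterior derivative. -/
def extD {p : ℕ} (α : DForm n M p) : DForm n M (p + 1) := fun x =>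
  (extDeriv (formInChart α x) (extChartAt (𝓡 n) x x)).compContinuousLinearMap (toModel x x)

/-- An orientation of `M`: a choice of an orientation of each tangent space such that every point
has a neighbourhood with a smooth positively oriented frame. -/
structure MOrientation (n : ℕ) (M : Type*) [TopologicalSpace M] [ChartedSpace (Model n) M]
    [IsManifold (𝓡 n) ∞ M] where
  /-- The orientation of `T_x M`. -/
  orient : (x : M) → Orientation ℝ (TangentSpace (𝓡 n) x) (Fin n)
  exists_frame : ∀ x : M, ∃ U ∈ 𝓝 x, ∃ X : Fin n → VField n M,
    (∀ i, ContMDiffOn (𝓡 n) (𝓡 n).tangent ∞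
      (fun y => (⟨y, X i y⟩ : TotalSpace (Model n) (TangentSpace (𝓡 n) : M → Type _))) U) ∧
    ∀ y ∈ U, ∃ b : Basis (Fin n) ℝ (TangentSpace (𝓡 n) y),
      (∀ i, b i = X i y) ∧ b.orientation = orient y

variable [RiemannianBundle (fun x : M => TangentSpace (𝓡 n) x)]

/-- The metric `g_{ij}` in the chart around `x`, as a bilinear form depending on `z ∈ ℝⁿ`. -/
def metricInChart (x : M) (z : Model n) : Model n →L[ℝ] Model n →L[ℝ] ℝ :=
  (innerSL ℝ (E := TangentSpace (𝓡 n) ((extChartAt (𝓡 n) x).symm z))).bilinearComp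
    (ofModel x z) (ofModel x z)

/-- The Christoffel map `a ↦ Γ(a, b)` at `x` in the chart around `x`: with `g` the metric in that
chart, `⟨Γ(a, b), c⟩ = (D_a g(b, c) + D_b g(a, c) - D_c g(b, a)) / 2`. It is symmetric in `a`
and `b`. -/
def christoffel (x : M) (b : TangentSpace (𝓡 n) x) :
    TangentSpace (𝓡 n) x →L[ℝ] TangentSpace (𝓡 n) x :=
  sharpL ∘L (christoffelForm (metricInChart x) (extChartAt (𝓡 n) x x)
    (toModel x x b)).bilinearComp (toModel x x) (toModel x x)

/-- The Levi-Civita connection on vector fields: `leviCivita Y x v = (∇_v Y)(x)`, which is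
`v(Y) + Γ(v, Y)` in the chart around `x`. -/
def leviCivita (Y : VField n M) (x : M) : TangentSpace (𝓡 n) x →L[ℝ] TangentSpace (𝓡 n) x :=
  (toModel x x).inverse ∘L fderiv ℝ (fieldInChart Y x) (extChartAt (𝓡 n) x x) ∘L toModel x x
  + christoffel x (Y x)

/-- The Levi-Civita connection on `p`-forms: `covForm α x v = (∇_v α)(x)`, which is
`v(α)(X₁, …, X_p) - ∑ᵢ α(X₁, …, Γ(v, Xᵢ), …, X_p)` in the chart around `x`. -/
def covForm {p : ℕ} (α : DForm n M p) (x : M) (v : TangentSpace (𝓡 n) x) :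
    TangentSpace (𝓡 n) x [⋀^Fin p]→L[ℝ] ℝ :=
  (fderiv ℝ (formInChart α x) (extChartAt (𝓡 n) x x)
      (toModel x x v)).compContinuousLinearMap (toModel x x)
  - insertEndo (α x) (christoffel x v)

/-- The `1`-form `Ã` dual to a vector field `A`. -/
def flat (A : VField n M) : DForm n M 1 := fun x =>
  ContinuousAlternatingMap.ofSubsingleton ℝ (TangentSpace (𝓡 n) x) ℝ (0 : Fin 1)
    (innerSL ℝ (A x))

/-- The vector field `α^♯` dual to a `1`-form `α`. -/
def sharpField (α : DForm n M 1) : VField n M := fun x =>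
  sharp ((ContinuousAlternatingMap.ofSubsingleton ℝ (TangentSpace (𝓡 n) x) ℝ
    (0 : Fin 1)).symm (α x))

/-- The gradient of a function. -/
def grad (f : M → ℝ) : VField n M := fun x =>
  sharp (mfderiv (𝓡 n) 𝓘(ℝ, ℝ) f x : TangentSpace (𝓡 n) x →L[ℝ] ℝ)

/-- The divergence `div A = Trace(∇A)`. -/
def div (A : VField n M) (x : M) : ℝ :=
  LinearMap.trace ℝ (TangentSpace (𝓡 n) x) (leviCivita A x).toLinearMap

/-- The symmetric part `∇ˢA` of `∇A`. -/
def symGrad (A : VField n M) (x : M) : TangentSpace (𝓡 n) x →L[ℝ] TangentSpace (𝓡 n) x :=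
  symPart (leviCivita A x)

variable [IsManifold (𝓡 n) ∞ M]

/-- The Hodge star on forms, `p + q = n`. -/
def star (o : MOrientation n M) {p q : ℕ} (h : p + q = n) (α : DForm n M p) : DForm n M q :=
  fun x => hodgeStar (o.orient x) h (α x)

/-- The codifferential `d^* = (-1)^{n(r+1)+1} ∗ d ∗` on forms of degree `r = p + 1`; it is the
formal `L²`-adjoint of the exterior derivative. -/
def codiff (o : MOrientation n M) {p q : ℕ} (h : (p + 1) + q = n) (α : DForm n M (p + 1)) :
    DForm n M p :=
  ((-1 : ℝ) ^ (n * ((p + 1) + 1) + 1)) •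
    star o (p := q + 1) (q := p) (by omega) (extD (star o h α))

/-- The De Rham–Hodge Laplacian `□ = d d^* + d^* d` on forms of degree `p + 1`, where
`0 < p + 1 < n`. -/
def hodgeLaplacian (o : MOrientation n M) {p q : ℕ} (h : (p + 1) + (q + 1) = n)
    (α : DForm n M (p + 1)) : DForm n M (p + 1) :=
  extD (codiff o h α) + codiff o (p := p + 1) (q := q) (by omega) (extD α)

end Manifold

/-! ### The Navier–Stokes equation and the vorticity in dimension three -/

section NavierStokes

variable {M : Type*} [TopologicalSpace M] [ChartedSpace (EuclideanSpace ℝ (Fin 3)) M]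
  [RiemannianBundle (fun x : M => TangentSpace (𝓡 3) x)] [IsManifold (𝓡 3) ∞ M]

/-- `□` on `1`-forms of a three-dimensional manifold. -/
def laplacianForm (o : MOrientation 3 M) (α : DForm 3 M 1) : DForm 3 M 1 :=
  hodgeLaplacian o (p := 0) (q := 1) rfl α

/-- `□A = (□Ã)^♯` on vector fields. -/
def laplacianField (o : MOrientation 3 M) (A : VField 3 M) : VField 3 M :=
  sharpField (laplacianForm o (flat A))

/-- The vorticity `∗ dũ` of a vector field `u`. -/
def vorticity (o : MOrientation 3 M) (u : VField 3 M) : DForm 3 M 1 :=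
  star o (p := 2) (q := 1) rfl (extD (flat u))

/-- `(u, p)` is a smooth solution on the time interval `J` of
`∂ₜu + ∇_u u + ν □u = -∇p`, `div u = 0`. -/
structure IsSmoothNSSolution (o : MOrientation 3 M) (ν : ℝ) (J : Set ℝ)
    (u : ℝ → VField 3 M) (p : ℝ → M → ℝ) : Prop where
  smooth_velocity : ContMDiffOn (𝓘(ℝ, ℝ).prod (𝓡 3)) (𝓡 3).tangent ∞
    (fun z : ℝ × M =>
      (⟨z.2, u z.1 z.2⟩ : TotalSpace (Model 3) (TangentSpace (𝓡 3) : M → Type _)))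
    (J ×ˢ Set.univ)
  smooth_pressure : ∀ t ∈ J, ContMDiff (𝓡 3) 𝓘(ℝ, ℝ) ∞ (p t)
  momentum : ∀ t ∈ J, ∀ x : M,
    derivWithin (fun s => u s x) J t + leviCivita (u t) x (u t x)
      + ν • laplacianField o (u t) x = - grad (p t) x
  incompressible : ∀ t ∈ J, ∀ x : M, div (u t) x = 0

end NavierStokes

end

end NSVorticity

/-!
In dimension three the field `W` dual to the vorticity `ω` is characterised by `ι_W vol = d ũ`, so
the vorticity equation can be computed with forms instead of components.

* Since `dd = 0`, the operator `∗d` annihilates `∇p`; it commutes with `□` (as `∗∗ = 1`) and with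
  `∂ₜ` (mixed partial derivatives commute, up to the end points of the time interval).
* The form dual to `∇_u u` is `ι_u dũ + ½ d|u|²`, so applying `d` gives `d ι_u ι_W vol`.
* Because `∇` is torsion-free, Cartan's formula reads `d ι_u β + ι_u dβ = ∇_u β + β ⊙ ∇u`. For
  `β = ι_W vol = dũ`, which is closed, `∇ vol = 0` and `div u = 0` turn this into
  `d ι_u ι_W vol = ι_Z vol` with `Z = ∇_u W - ∇_W u`, so `∗d` of the advection term is dual to `Z`.
* The antisymmetric part of `∇u` is `½ dũ = ½ ι_W vol`, which vanishes on `W`; so `∇_W u` is dual to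
  `ω ⊙ ∇ˢu`.
-/

namespace NSVorticity

noncomputable section

section TopDegreeForms

variable {V : Type*} [AddCommGroup V] [Module ℝ V]

theorem alternatingMap_update_basis {ι : Type*} [Finite ι] [DecidableEq ι]
    (f : V [⋀^ι]→ₗ[ℝ] ℝ) (b : Basis ι ℝ V) (i : ι) (w : V) :
    f (Function.update b i w) = b.repr w i * f b := by
  cases nonempty_fintype ι
  conv_lhs => rw [← b.sum_repr w, f.map_update_sum]
  rw [Finset.sum_eq_single_of_mem i (Finset.mem_univ i)]
  · rw [f.map_update_smul, Function.update_eq_self, smul_eq_mul]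
  · intro j _ hji
    rw [f.map_update_smul, f.map_update_self b hji.symm, smul_zero]

variable [TopologicalSpace V]

theorem insertEndo_eq_trace_smul {n : ℕ} [FiniteDimensional ℝ V] (hn : finrank ℝ V = n)
    (f : V [⋀^Fin n]→L[ℝ] ℝ) (T : V →L[ℝ] V) :
    insertEndo f T = LinearMap.trace ℝ V T.toLinearMap • f := by
  have halternating : (insertEndo f T).toAlternatingMap
      = (LinearMap.trace ℝ V T.toLinearMap • f).toAlternatingMap := by
    let b₀ := (Module.finBasis ℝ V).reindex (finCongr hn)
    refine Basis.ext_alternating b₀ fun σ hσ => ?_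
    let b := b₀.reindex (Equiv.ofBijective σ (Finite.injective_iff_bijective.1 hσ)).symm
    have hb : (fun i => b₀ (σ i)) = b := by ext i; simp [b]
    rw [hb]
    change ∑ i, f.toAlternatingMap (Function.update b i (T (b i))) = _ * f.toAlternatingMap b
    rw [LinearMap.trace_eq_matrix_trace ℝ b, Matrix.trace, Finset.sum_mul]
    simp only [alternatingMap_update_basis, Matrix.diag_apply, LinearMap.toMatrix_apply,
      ContinuousLinearMap.coe_coe]
  exact ContinuousAlternatingMap.toAlternatingMap_injective halternating

end TopDegreeForms

section InteriorProduct

variable {E : Type*} [NormedAddCommGroup E] [NormedSpace ℝ E] [FiniteDimensional ℝ E] {q : ℕ}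

theorem finrank_alternatingMap (p : ℕ) :
    finrank ℝ (E [⋀^Fin p]→ₗ[ℝ] ℝ) = (finrank ℝ E).choose p := by
  rw [(exteriorPower.alternatingMapLinearEquiv (R := ℝ) (M := E) (N := ℝ) (n := p)).finrank_eq]
  exact Subspace.dual_finrank_eq.trans (exteriorPower.finrank_eq ℝ p)

theorem curryLeft_injective_of_ne_zero (hE : finrank ℝ E = q + 1)
    {f : E [⋀^Fin (q + 1)]→L[ℝ] ℝ} (hf : f ≠ 0) : Function.Injective f.curryLeft := by
  let b := (Module.finBasis ℝ E).reindex (finCongr hE)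
  have hfb : f.toAlternatingMap b ≠ 0 := (AlternatingMap.map_basis_ne_zero_iff b _).2 fun h =>
    hf (ContinuousAlternatingMap.toAlternatingMap_injective h)
  refine (injective_iff_map_eq_zero f.curryLeft).2 fun w hw => b.repr.map_eq_zero_iff.1 ?_
  ext i
  have hupdate : f.toAlternatingMap (Function.update b i w) = 0 := by
    rw [← Fin.insertNth_removeNth, AlternatingMap.map_insertNth]
    exact smul_eq_zero_of_right _ (DFunLike.congr_fun hw (i.removeNth b))
  rw [alternatingMap_update_basis] at hupdate
  exact (mul_eq_zero.1 hupdate).resolve_right hfb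

theorem exists_curryLeft_eq (hE : finrank ℝ E = q + 1)
    {f : E [⋀^Fin (q + 1)]→L[ℝ] ℝ} (hf : f ≠ 0) (β : E [⋀^Fin q]→L[ℝ] ℝ) :
    ∃ w, f.curryLeft w = β := by
  let L : E →ₗ[ℝ] E [⋀^Fin q]→ₗ[ℝ] ℝ := f.toAlternatingMap.curryLeft
  have hL : Function.Injective L :=
    ContinuousAlternatingMap.toAlternatingMap_injective.comp (curryLeft_injective_of_ne_zero hE hf)
  have hdim : finrank ℝ E = finrank ℝ (E [⋀^Fin q]→ₗ[ℝ] ℝ) := by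
    rw [finrank_alternatingMap, hE, Nat.choose_succ_self_right]
  have : FiniteDimensional ℝ (E [⋀^Fin q]→ₗ[ℝ] ℝ) :=
    Module.finite_of_finrank_pos (by omega)
  obtain ⟨w, hw⟩ := (LinearMap.injective_iff_surjective_of_finrank_eq_finrank hdim).1 hL
    β.toAlternatingMap
  exact ⟨w, ContinuousAlternatingMap.toAlternatingMap_injective hw⟩

end InteriorProduct

section VolumeForm

variable {V : Type*} [NormedAddCommGroup V] [InnerProductSpace ℝ V] {n q : ℕ}
  [Fact (finrank ℝ V = n)]

/-- The volume form of an oriented Euclidean space, as a continuous alternating map. -/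
def contVolumeForm (o : Orientation ℝ V (Fin n)) : V [⋀^Fin n]→L[ℝ] ℝ :=
  o.volumeForm.mkContinuous 1 fun v => by
    simpa only [one_mul, Real.norm_eq_abs] using o.abs_volumeForm_apply_le v

theorem volumeForm_mul_volumeForm (o : Orientation ℝ V (Fin n)) (b : OrthonormalBasis (Fin n) ℝ V)
    (v w : Fin n → V) :
    o.volumeForm v * o.volumeForm w = b.toBasis.det v * b.toBasis.det w := by
  by_cases hb : b.toBasis.orientation = o
  · rw [o.volumeForm_robust b hb]
  · rw [o.volumeForm_robust_neg b hb, AlternatingMap.neg_apply, AlternatingMap.neg_apply,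
      neg_mul_neg]

theorem volumeForm_pos (o : Orientation ℝ V (Fin n)) (b : Basis (Fin n) ℝ V)
    (hb : b.orientation = o) : 0 < o.volumeForm b := by
  subst hb
  obtain rfl | hn := n.eq_zero_or_pos
  · rw [b.orientation_isEmpty, Orientation.volumeForm_zero_pos]
    exact one_pos
  · have he := b.orientation.finOrthonormalBasis_orientation hn Fact.out
    rw [b.orientation.volumeForm_robust _ he]
    exact (Basis.orientation_eq_iff_det_pos _ b).1 he

theorem volumeForm_sq [FiniteDimensional ℝ V] (o : Orientation ℝ V (Fin n)) (v : Fin n → V) :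
    o.volumeForm v ^ 2 = (Matrix.gram ℝ v).det := by
  let b := (stdOrthonormalBasis ℝ V).reindex (finCongr (Fact.out : finrank ℝ V = n))
  rw [sq, volumeForm_mul_volumeForm o b, Matrix.gram_eq_conjTranspose_mul b, Matrix.det_mul,
    Matrix.det_conjTranspose, Basis.det_apply]
  rfl

theorem contractVol_one_left [Fact (finrank ℝ V = q + 1)]
    (o : Orientation ℝ V (Fin (q + 1))) (h : 1 + q = q + 1) (a : Fin 1 → V) :
    contractVol o h a = (contVolumeForm o).curryLeft (a 0) := by
  ext v
  exact congrArg o.volumeForm (by rw [Fin.append_left_eq_cons]; rfl)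

theorem contractVol_one_right [Fact (finrank ℝ V = q + 1)]
    (o : Orientation ℝ V (Fin (q + 1))) (h : q + 1 = q + 1) (a : Fin q → V) (v : Fin 1 → V) :
    contractVol o h a v = contVolumeForm o (Fin.snoc a (v 0)) :=
  congrArg o.volumeForm (by rw [Fin.append_right_eq_snoc]; rfl)

end VolumeForm

theorem append_comp {X Y : Type*} {p q : ℕ} (g : X → Y) (a : Fin p → X) (v : Fin q → X) :
    Fin.append (g ∘ a) (g ∘ v) = g ∘ Fin.append a v :=
  funext fun i => Fin.addCases (fun j => by simp) (fun j => by simp) i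

theorem multilinearMap_apply_sum_smul {V ι : Type*} [AddCommGroup V] [Module ℝ V] [Fintype ι]
    {p : ℕ} (Φ : MultilinearMap ℝ (fun _ : Fin p => V) ℝ) (c : Fin p → ι → ℝ) (y : ι → V) :
    Φ (fun k => ∑ j, c k j • y j) = ∑ g : Fin p → ι, (∏ k, c k (g k)) * Φ (y ∘ g) := by
  classical
  rw [Φ.map_sum]
  exact Finset.sum_congr rfl fun g _ => Φ.map_smul_univ _ _

section HodgeStar

variable {V : Type*} [NormedAddCommGroup V] [InnerProductSpace ℝ V] {n p q : ℕ}

theorem sum_orthonormalBasis_eq_sum_dual {ι κ : Type*} [Fintype ι] [Fintype κ]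
    (Φ Ψ : MultilinearMap ℝ (fun _ : Fin p => V) ℝ) (b : OrthonormalBasis ι ℝ V) {e e' : κ → V}
    (hdual : ∀ x, ∑ j, inner ℝ (e j) x • e' j = x) :
    ∑ f : Fin p → ι, Φ (b ∘ f) * Ψ (b ∘ f) = ∑ g : Fin p → κ, Φ (e' ∘ g) * Ψ (e ∘ g) := by
  have hΦ : ∀ f : Fin p → ι, Φ (b ∘ f)
      = ∑ g : Fin p → κ, (∏ k, inner ℝ (e (g k)) (b (f k))) * Φ (e' ∘ g) := fun f => by
    rw [← multilinearMap_apply_sum_smul Φ fun k j => inner ℝ (e j) (b (f k))]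
    simp only [hdual, Function.comp_def]
  have hΨ : ∀ g : Fin p → κ, Ψ (e ∘ g)
      = ∑ f : Fin p → ι, (∏ k, inner ℝ (e (g k)) (b (f k))) * Ψ (b ∘ f) := fun g => by
    have hexp : ∀ k, e (g k) = ∑ i, (inner ℝ (e (g k)) (b i) : ℝ) • b i := fun k => by
      simp only [fun i => real_inner_comm (b i) (e (g k)), b.sum_repr']
    rw [← multilinearMap_apply_sum_smul Ψ fun k i => inner ℝ (e (g k)) (b i)]
    exact congrArg Ψ (funext hexp)
  simp only [hΦ, hΨ, Finset.sum_mul, Finset.mul_sum]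
  rw [Finset.sum_comm]
  exact Finset.sum_congr rfl fun g _ => Finset.sum_congr rfl fun f _ => by ring

theorem inner_sharp [FiniteDimensional ℝ V] (α : V →L[ℝ] ℝ) (v : V) :
    inner ℝ (sharp α) v = α v := by
  have : CompleteSpace V := FiniteDimensional.complete ℝ V
  exact InnerProductSpace.toDual_symm_apply

theorem det_toBasis_three (b : OrthonormalBasis (Fin 3) ℝ V) (x y z : V) :
    b.toBasis.det ![x, y, z] =
      inner ℝ (b 0) x * inner ℝ (b 1) y * inner ℝ (b 2) z
        - inner ℝ (b 0) x * inner ℝ (b 2) y * inner ℝ (b 1) z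
        - inner ℝ (b 1) x * inner ℝ (b 0) y * inner ℝ (b 2) z
        + inner ℝ (b 2) x * inner ℝ (b 0) y * inner ℝ (b 1) z
        + inner ℝ (b 1) x * inner ℝ (b 2) y * inner ℝ (b 0) z
        - inner ℝ (b 2) x * inner ℝ (b 1) y * inner ℝ (b 0) z := by
  rw [Basis.det_apply, Matrix.det_fin_three]
  simp only [Basis.toMatrix_apply, OrthonormalBasis.coe_toBasis_repr_apply,
    OrthonormalBasis.repr_apply_apply, Matrix.cons_val_zero, Matrix.cons_val_one, Matrix.cons_val]
  ring

variable [Fact (finrank ℝ V = n)]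

theorem exists_multilinearMap_contractVol (o : Orientation ℝ V (Fin n)) (h : p + q = n)
    (v : Fin q → V) :
    ∃ Φ : MultilinearMap ℝ (fun _ : Fin p => V) ℝ, ∀ a, contractVol o h a v = Φ a := by
  subst h
  let Φ := (o.volumeForm.toMultilinearMap.domDomCongr finSumFinEquiv.symm).currySum
  let evalAt : MultilinearMap ℝ (fun _ : Fin q => V) ℝ →ₗ[ℝ] ℝ :=
    { toFun := fun Ψ => Ψ v
      map_add' := fun _ _ => rfl
      map_smul' := fun _ _ => rfl }
  exact ⟨evalAt.compMultilinearMap Φ, fun a => congrArg o.volumeForm <| funext fun i =>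
    Fin.addCases (fun j => by simp) (fun j => by simp) i⟩

variable [FiniteDimensional ℝ V]

theorem hodgeStar_apply_of_dual (o : Orientation ℝ V (Fin n)) (h : p + q = n)
    {κ : Type*} [Fintype κ] {e e' : κ → V} (hdual : ∀ x, ∑ j, inner ℝ (e j) x • e' j = x)
    (β : V [⋀^Fin p]→L[ℝ] ℝ) (v : Fin q → V) :
    hodgeStar o h β v
      = (p.factorial : ℝ)⁻¹ * ∑ f : Fin p → κ, β (e' ∘ f) * contractVol o h (e ∘ f) v := by
  obtain ⟨Φ, hΦ⟩ := exists_multilinearMap_contractVol o h v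
  have hsum := sum_orthonormalBasis_eq_sum_dual β.toMultilinearMap Φ (stdOrthonormalBasis ℝ V) hdual
  simp only [← hΦ] at hsum
  refine .trans ?_ (congrArg _ hsum)
  simp only [hodgeStar, ContinuousAlternatingMap.smul_apply,
    ContinuousAlternatingMap.sum_apply, smul_eq_mul]
  rfl

theorem hodgeStar_apply (o : Orientation ℝ V (Fin n)) (h : p + q = n)
    {κ : Type*} [Fintype κ] (b : OrthonormalBasis κ ℝ V) (β : V [⋀^Fin p]→L[ℝ] ℝ)
    (v : Fin q → V) :
    hodgeStar o h β v
      = (p.factorial : ℝ)⁻¹ * ∑ f : Fin p → κ, β (b ∘ f) * contractVol o h (b ∘ f) v :=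
  hodgeStar_apply_of_dual o h b.sum_repr' β v

theorem hodgeStar_ofSubsingleton [Fact (finrank ℝ V = q + 1)] (o : Orientation ℝ V (Fin (q + 1)))
    (h : 1 + q = q + 1) (w : V) :
    hodgeStar o h (ContinuousAlternatingMap.ofSubsingleton ℝ V ℝ (0 : Fin 1) (innerSL ℝ w))
      = (contVolumeForm o).curryLeft w := by
  let b := stdOrthonormalBasis ℝ V
  ext v
  calc _ = ((1 : ℕ).factorial : ℝ)⁻¹ * ∑ f : Fin 1 → Fin (finrank ℝ V),
        inner ℝ w (b (f 0)) * (contVolumeForm o).curryLeft (b (f 0)) v := by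
        simp only [hodgeStar_apply o h b, contractVol_one_left]
        rfl
    _ = ∑ i, inner ℝ w (b i) * (contVolumeForm o).curryLeft (b i) v := by
        rw [Nat.factorial_one, Nat.cast_one, inv_one, one_mul]
        exact Fintype.sum_equiv (Equiv.funUnique (Fin 1) _) _ _ fun f => rfl
    _ = (contVolumeForm o).curryLeft (∑ i, inner ℝ (b i) w • b i) v := by
        simp only [map_sum, map_smul, ContinuousAlternatingMap.sum_apply,
          ContinuousAlternatingMap.smul_apply, smul_eq_mul, real_inner_comm]
    _ = _ := by rw [b.sum_repr']

theorem hodgeStar_curryLeft_volumeForm [Fact (finrank ℝ V = 3)] (o : Orientation ℝ V (Fin 3))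
    (h : 2 + 1 = 3) (w : V) :
    hodgeStar o h ((contVolumeForm o).curryLeft w)
      = ContinuousAlternatingMap.ofSubsingleton ℝ V ℝ (0 : Fin 1) (innerSL ℝ w) := by
  let b := (stdOrthonormalBasis ℝ V).reindex (finCongr (Fact.out : finrank ℝ V = 3))
  have hb := orthonormal_iff_ite.1 b.orthonormal
  ext v
  have hterm : ∀ f : Fin 2 → Fin 3, (contVolumeForm o).curryLeft w (b ∘ f) *
      contractVol o h (b ∘ f) v
        = b.toBasis.det ![w, b (f 0), b (f 1)] * b.toBasis.det ![b (f 0), b (f 1), v 0] :=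
    fun f => by
      rw [contractVol_one_right, ← volumeForm_mul_volumeForm o b]
      congr 1 <;> refine congrArg o.volumeForm ?_ <;> ext i <;> fin_cases i <;> rfl
  have hsum : ∑ f : Fin 2 → Fin 3,
      b.toBasis.det ![w, b (f 0), b (f 1)] * b.toBasis.det ![b (f 0), b (f 1), v 0]
        = 2 * ∑ i, inner ℝ w (b i) * inner ℝ (b i) (v 0) := by
    refine (Fintype.sum_equiv (finTwoArrowEquiv (Fin 3)) _
      (fun i => b.toBasis.det ![w, b i.1, b i.2] * b.toBasis.det ![b i.1, b i.2, v 0])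
      fun f => rfl).trans ?_
    rw [Fintype.sum_prod_type]
    simp only [det_toBasis_three, hb, Fin.sum_univ_three, Fin.isValue, real_inner_comm w]
    simp only [Fin.isValue, one_ne_zero, ↓reduceIte, mul_zero, Fin.reduceEq, sub_self, mul_one,
      add_zero, zero_mul, zero_add, zero_ne_one, sub_zero, one_mul, zero_sub, mul_neg, neg_mul,
      neg_neg]
    ring
  simp only [hodgeStar_apply o h b, hterm, hsum, b.sum_inner_mul_inner]
  simp [Nat.factorial]

end HodgeStar

section SmoothFamilies

variable {D E : Type*} [NormedAddCommGroup D] [NormedSpace ℝ D] [NormedAddCommGroup E]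
  [NormedSpace ℝ E] [FiniteDimensional ℝ E] {p : ℕ} {m : WithTop ℕ∞} {s : Set D}
  {η : D → E [⋀^Fin p]→L[ℝ] ℝ}

theorem contDiffOn_alternating_iff :
    ContDiffOn ℝ m η s ↔ ∀ v, ContDiffOn ℝ m (fun z => η z v) s := by
  refine ⟨fun h v => (ContinuousAlternatingMap.apply ℝ E ℝ v).contDiff.comp_contDiffOn h,
    fun h => ?_⟩
  let b := Module.finBasis ℝ E
  let evalBasis : (E [⋀^Fin p]→L[ℝ] ℝ) →ₗ[ℝ] ((Fin p → Fin (finrank ℝ E)) → ℝ) :=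
    { toFun := fun η f => η fun i => b (f i)
      map_add' := fun _ _ => rfl
      map_smul' := fun _ _ => rfl }
  have hinj : Function.Injective evalBasis := fun η₁ η₂ h =>
    ContinuousAlternatingMap.toAlternatingMap_injective
      (Basis.ext_alternating b fun f _ => congrFun h f)
  obtain ⟨S, hS⟩ := evalBasis.exists_leftInverse_of_injective (LinearMap.ker_eq_bot.2 hinj)
  have hη : η = fun z => LinearMap.toContinuousLinearMap S (evalBasis (η z)) :=
    funext fun z => (LinearMap.congr_fun hS (η z)).symm
  rw [hη]
  exact (LinearMap.toContinuousLinearMap S).contDiff.comp_contDiffOn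
    (contDiffOn_pi.2 fun f => h fun i => b (f i))

theorem contDiffOn_alternatingMap_apply {v : D → Fin p → E} (hη : ContDiffOn ℝ m η s)
    (hv : ∀ i, ContDiffOn ℝ m (fun z => v z i) s) : ContDiffOn ℝ m (fun z => η z (v z)) s := by
  let b := Module.finBasis ℝ E
  have hexp : ∀ z, η z (v z) = ∑ g : Fin p → Fin (finrank ℝ E),
      (∏ k, b.repr (v z k) (g k)) * η z (b ∘ g) := fun z => by
    refine .trans ?_ (multilinearMap_apply_sum_smul (η z).toMultilinearMap
      (fun k j => b.repr (v z k) j) b)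
    simp only [b.sum_repr]
    rfl
  have hcoord : ∀ k j, ContDiffOn ℝ m (fun z => b.repr (v z k) j) s := fun k j =>
    (LinearMap.toContinuousLinearMap (b.coord j)).contDiff.comp_contDiffOn (hv k)
  simp only [hexp]
  exact ContDiffOn.sum fun g _ => (contDiffOn_prod fun k _ => hcoord k (g k)).mul
    (contDiffOn_alternating_iff.1 hη _)

theorem contDiffOn_det {ι : Type*} [Fintype ι] [DecidableEq ι] {A : D → Matrix ι ι ℝ}
    (hA : ∀ i j, ContDiffOn ℝ m (fun z => A z i j) s) :
    ContDiffOn ℝ m (fun z => (A z).det) s := by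
  simp only [Matrix.det_apply]
  exact ContDiffOn.sum fun σ _ => (contDiffOn_prod fun i _ => hA _ _).const_smul _

theorem contDiffOn_of_apply_frame (b : Basis (Fin p) ℝ E) {X : D → Fin p → E}
    (hX : ∀ i, ContDiffOn ℝ m (fun z => X z i) s)
    (hηX : ContDiffOn ℝ m (fun z => η z (X z)) s) (hne : ∀ z ∈ s, η z (X z) ≠ 0) :
    ContDiffOn ℝ m η s := by
  have hbasis : ∀ z v, η z v = η z b * b.det v := fun z v =>
    congrArg (· v) ((η z).toAlternatingMap.eq_smul_basis_det b)
  have hdet : ContDiffOn ℝ m (fun z => b.det (X z)) s := contDiffOn_det fun i j =>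
    (LinearMap.toContinuousLinearMap (b.coord i)).contDiff.comp_contDiffOn (hX j)
  have hdet0 : ∀ z ∈ s, b.det (X z) ≠ 0 := fun z hz hzero =>
    hne z hz (by rw [hbasis, hzero, mul_zero])
  refine contDiffOn_alternating_iff.2 fun v =>
    ((hηX.div hdet hdet0).mul (contDiffOn_const (c := b.det v))).congr fun z hz => ?_
  rw [Pi.div_apply, hbasis z (X z), mul_div_cancel_right₀ _ (hdet0 z hz), hbasis z v]

end SmoothFamilies

section Charts

variable {n p : ℕ} {M : Type*} [TopologicalSpace M] [ChartedSpace (EuclideanSpace ℝ (Fin n)) M]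
  {α β : DForm n M p}

theorem minSmoothness_two_le : minSmoothness ℝ 2 ≤ (∞ : WithTop ℕ∞) := by
  rw [minSmoothness_of_isRCLikeNormedField]
  exact WithTop.coe_le_coe.2 le_top

theorem isOpen_target (x : M) : IsOpen (extChartAt (𝓡 n) x).target :=
  isOpen_extChartAt_target x

/-- Smoothness of a differential form, tested in every preferred chart. -/
def SmoothForm (α : DForm n M p) : Prop :=
  ∀ x : M, ContDiffOn ℝ ∞ (formInChart α x) (extChartAt (𝓡 n) x).target

/-- Smoothness of a vector field, tested in every preferred chart. -/
def SmoothField (Y : VField n M) : Prop :=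
  ∀ x : M, ContDiffOn ℝ ∞ (fieldInChart Y x) (extChartAt (𝓡 n) x).target

theorem SmoothForm.contDiffAt (hα : SmoothForm α) (x : M) :
    ContDiffAt ℝ ∞ (formInChart α x) (extChartAt (𝓡 n) x x) :=
  (hα x).contDiffAt (extChartAt_target_mem_nhds x)

theorem SmoothForm.differentiableAt (hα : SmoothForm α) (x : M) :
    DifferentiableAt ℝ (formInChart α x) (extChartAt (𝓡 n) x x) :=
  (hα.contDiffAt x).differentiableAt (by simp)

theorem SmoothField.differentiableAt {Y : VField n M} (hY : SmoothField Y) (x : M) :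
    DifferentiableAt ℝ (fieldInChart Y x) (extChartAt (𝓡 n) x x) :=
  ((hY x).contDiffAt (extChartAt_target_mem_nhds x)).differentiableAt (by simp)

theorem SmoothForm.add (hα : SmoothForm α) (hβ : SmoothForm β) : SmoothForm (α + β) :=
  fun x => (hα x).add (hβ x)

theorem SmoothForm.smul (hα : SmoothForm α) (c : ℝ) : SmoothForm (c • α) :=
  fun x => (hα x).const_smul c

theorem extD_smul (c : ℝ) (α : DForm n M p) : extD (c • α) = c • extD α := by
  funext x
  have : formInChart (c • α) x = c • formInChart α x := rfl
  rw [extD, this, extDeriv_smul]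
  rfl

theorem extD_zero : extD (0 : DForm n M p) = 0 := by
  simpa only [zero_smul] using extD_smul 0 (0 : DForm n M p)

theorem extD_add (hα : SmoothForm α) (hβ : SmoothForm β) : extD (α + β) = extD α + extD β := by
  funext x
  have : formInChart (α + β) x = formInChart α x + formInChart β x := rfl
  rw [extD, this, extDeriv_add (hα.differentiableAt x) (hβ.differentiableAt x)]
  rfl

variable [IsManifold (𝓡 n) ∞ M]

theorem toModel_ofModel (x : M) {z : Model n} (hz : z ∈ (extChartAt (𝓡 n) x).target)
    (a : Model n) : toModel x ((extChartAt (𝓡 n) x).symm z) (ofModel x z a) = a := by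
  have h := mfderiv_extChartAt_comp_mfderivWithin_extChartAt_symm (I := 𝓡 n) hz
  rw [(𝓡 n).range_eq_univ, mfderivWithin_univ] at h
  exact DFunLike.congr_fun h a

theorem ofModel_toModel (x : M) {z : Model n} (hz : z ∈ (extChartAt (𝓡 n) x).target)
    (v : TangentSpace (𝓡 n) ((extChartAt (𝓡 n) x).symm z)) :
    ofModel x z (toModel x ((extChartAt (𝓡 n) x).symm z) v) = v := by
  have h := mfderivWithin_extChartAt_symm_comp_mfderiv_extChartAt (I := 𝓡 n) hz
  rw [(𝓡 n).range_eq_univ, mfderivWithin_univ] at h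
  exact DFunLike.congr_fun h v

theorem ofModel_fieldInChart (Y : VField n M) (x : M) {z : Model n}
    (hz : z ∈ (extChartAt (𝓡 n) x).target) :
    ofModel x z (fieldInChart Y x z) = Y ((extChartAt (𝓡 n) x).symm z) :=
  ofModel_toModel x hz _

theorem formInChart_comp_toModel (α : DForm n M p) (x : M) {y : M}
    (hy : y ∈ (extChartAt (𝓡 n) x).source) :
    (formInChart α x (extChartAt (𝓡 n) x y)).compContinuousLinearMap (toModel x y) = α y := by
  obtain ⟨z, hz, rfl⟩ : ∃ z ∈ (extChartAt (𝓡 n) x).target, (extChartAt (𝓡 n) x).symm z = y :=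
    ⟨_, (extChartAt (𝓡 n) x).map_source hy, (extChartAt (𝓡 n) x).left_inv hy⟩
  rw [(extChartAt (𝓡 n) x).right_inv hz]
  ext v
  exact congrArg (α _) (funext fun i => ofModel_toModel x hz (v i))

theorem formInChart_eq_of_mem_source (α : DForm n M p) (x y : M) {z : Model n}
    (hy : (extChartAt (𝓡 n) x).symm z ∈ (extChartAt (𝓡 n) y).source) :
    formInChart α x z =
      (formInChart α y (extChartAt (𝓡 n) y ((extChartAt (𝓡 n) x).symm z))).compContinuousLinearMap
        (toModel y ((extChartAt (𝓡 n) x).symm z) ∘L ofModel x z) := by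
  conv_lhs => rw [formInChart, ← formInChart_comp_toModel α y hy]
  rfl

theorem contMDiffAt_extChartAt_symm (x : M) {z : Model n} (hz : z ∈ (extChartAt (𝓡 n) x).target) :
    ContMDiffAt 𝓘(ℝ, Model n) (𝓡 n) ∞ (extChartAt (𝓡 n) x).symm z :=
  (contMDiffOn_extChartAt_symm x).contMDiffAt ((isOpen_target x).mem_nhds hz)

theorem contMDiffAt_extChartAt_of_mem_source (x : M) {y : M}
    (hy : y ∈ (extChartAt (𝓡 n) x).source) :
    ContMDiffAt (𝓡 n) 𝓘(ℝ, Model n) ∞ (extChartAt (𝓡 n) x) y :=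
  contMDiffAt_extChartAt' (by rwa [extChartAt_source] at hy)

theorem contDiffAt_transition (x y : M) {z : Model n} (hz : z ∈ (extChartAt (𝓡 n) x).target)
    (hy : (extChartAt (𝓡 n) x).symm z ∈ (extChartAt (𝓡 n) y).source) :
    ContDiffAt ℝ ∞ (fun z' => extChartAt (𝓡 n) y ((extChartAt (𝓡 n) x).symm z')) z :=
  contMDiffAt_iff_contDiffAt.1 <|
    (contMDiffAt_extChartAt_of_mem_source y hy).comp z (contMDiffAt_extChartAt_symm x hz)

theorem fderiv_transition (x y : M) {z : Model n} (hz : z ∈ (extChartAt (𝓡 n) x).target)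
    (hy : (extChartAt (𝓡 n) x).symm z ∈ (extChartAt (𝓡 n) y).source) :
    fderiv ℝ (fun z' => extChartAt (𝓡 n) y ((extChartAt (𝓡 n) x).symm z')) z
      = toModel y ((extChartAt (𝓡 n) x).symm z) ∘L ofModel x z := by
  rw [← mfderiv_eq_fderiv]
  exact mfderiv_comp z
    ((contMDiffAt_extChartAt_of_mem_source y hy).mdifferentiableAt (by simp))
    ((contMDiffAt_extChartAt_symm x hz).mdifferentiableAt (by simp))

theorem formInChart_extD (hα : SmoothForm α) (x : M) {z : Model n}
    (hz : z ∈ (extChartAt (𝓡 n) x).target) :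
    formInChart (extD α) x z = extDeriv (formInChart α x) z := by
  set y := (extChartAt (𝓡 n) x).symm z
  have hy : y ∈ (extChartAt (𝓡 n) y).source := mem_extChartAt_source y
  have hpullback : formInChart α x =ᶠ[𝓝 z] fun z' =>
      (formInChart α y (extChartAt (𝓡 n) y ((extChartAt (𝓡 n) x).symm z'))).compContinuousLinearMap
        (fderiv ℝ (fun z' => extChartAt (𝓡 n) y ((extChartAt (𝓡 n) x).symm z')) z') := by
    have hcont : ContinuousAt (extChartAt (𝓡 n) x).symm z := continuousAt_extChartAt_symm'' hz
    filter_upwards [(isOpen_target x).mem_nhds hz,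
      hcont.preimage_mem_nhds ((isOpen_extChartAt_source y).mem_nhds hy)] with z' hz' hz''
    rw [fderiv_transition x y hz' hz'']
    exact formInChart_eq_of_mem_source α x y hz''
  rw [hpullback.extDeriv_eq, extDeriv_pullback (r := ∞) _ (contDiffAt_transition x y hz hy)
    minSmoothness_two_le, fderiv_transition x y hz hy]
  · rfl
  · exact hα.differentiableAt y

theorem SmoothForm.extD (hα : SmoothForm α) : SmoothForm (extD α) := fun x => by
  have hfderiv := (hα x).fderiv_of_isOpen (isOpen_target x) (m := ∞) (by simp)
  let L : (Model n →L[ℝ] Model n [⋀^Fin p]→L[ℝ] ℝ) →L[ℝ] Model n [⋀^Fin (p + 1)]→L[ℝ] ℝ :=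
    ContinuousAlternatingMap.alternatizeUncurryFinCLM ℝ (Model n) ℝ
  have hextDeriv : ContDiffOn ℝ ∞ (L ∘ fderiv ℝ (formInChart α x)) (extChartAt (𝓡 n) x).target :=
    L.contDiff.comp_contDiffOn hfderiv
  exact hextDeriv.congr fun z hz => formInChart_extD hα x hz

theorem extD_extD (hα : SmoothForm α) : NSVorticity.extD (NSVorticity.extD α) = 0 := by
  funext x
  have hev : formInChart (NSVorticity.extD α) x =ᶠ[𝓝 (extChartAt (𝓡 n) x x)]
      extDeriv (formInChart α x) := by
    filter_upwards [extChartAt_target_mem_nhds x] with z hz using formInChart_extD hα x hz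
  rw [NSVorticity.extD, hev.extDeriv_eq,
    extDeriv_extDeriv_apply (hα.contDiffAt x) minSmoothness_two_le]
  rfl

end Charts

section SmoothFields

variable {n : ℕ} {M : Type*} [TopologicalSpace M] [ChartedSpace (EuclideanSpace ℝ (Fin n)) M]
  [IsManifold (𝓡 n) ∞ M]

theorem contMDiffOn_fieldAlong_iff {EN HN N : Type*} [NormedAddCommGroup EN] [NormedSpace ℝ EN]
    [TopologicalSpace HN] {IN : ModelWithCorners ℝ EN HN} [TopologicalSpace N] [ChartedSpace HN N]
    (x : M) {f : N → M} {v : (q : N) → TangentSpace (𝓡 n) (f q)} {s : Set N}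
    (hs : Set.MapsTo f s (extChartAt (𝓡 n) x).source) :
    ContMDiffOn IN (𝓡 n).tangent ∞
        (fun q => (⟨f q, v q⟩ : TotalSpace (Model n) (TangentSpace (𝓡 n) : M → Type _))) s ↔
      ContMDiffOn IN (𝓡 n) ∞ f s ∧
        ContMDiffOn IN 𝓘(ℝ, Model n) ∞ (fun q => toModel x (f q) (v q)) s := by
  have hs' : ∀ q ∈ s, f q ∈ (chartAt (EuclideanSpace ℝ (Fin n)) x).source := fun q hq => by
    simpa only [extChartAt_source] using hs hq
  refine ((trivializationAt (Model n) (TangentSpace (𝓡 n) : M → Type _) x).contMDiffOn_iff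
    fun q hq => ?_).trans (and_congr_right fun _ => contMDiffOn_congr fun q hq => ?_)
  · rw [Trivialization.mem_source]
    exact hs' q hq
  · rw [toModel, ← TangentBundle.continuousLinearMapAt_trivializationAt (hs' q hq),
      Trivialization.continuousLinearMapAt_apply_of_mem]
    exact hs' q hq

theorem contMDiffOn_ofModel (x : M) (a : Model n) :
    ContMDiffOn 𝓘(ℝ, Model n) (𝓡 n).tangent ∞
      (fun z => (⟨(extChartAt (𝓡 n) x).symm z, ofModel x z a⟩ :
        TotalSpace (Model n) (TangentSpace (𝓡 n) : M → Type _))) (extChartAt (𝓡 n) x).target :=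
  (contMDiffOn_fieldAlong_iff x fun _ hz => (extChartAt (𝓡 n) x).map_target hz).2
    ⟨contMDiffOn_extChartAt_symm x,
      contMDiffOn_const.congr fun _ hz => toModel_ofModel x hz a⟩

theorem contDiffOn_fieldInChart {U : Set M} {Y : VField n M}
    (hY : ContMDiffOn (𝓡 n) (𝓡 n).tangent ∞
      (fun y => (⟨y, Y y⟩ : TotalSpace (Model n) (TangentSpace (𝓡 n) : M → Type _))) U) (x : M) :
    ContDiffOn ℝ ∞ (fieldInChart Y x)
      ((extChartAt (𝓡 n) x).target ∩ (extChartAt (𝓡 n) x).symm ⁻¹' U) :=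
  contMDiffOn_iff_contDiffOn.1 <|
    ((contMDiffOn_fieldAlong_iff x fun _ hq => hq.1).1 (hY.mono Set.inter_subset_right)).2.comp
      ((contMDiffOn_extChartAt_symm x).mono Set.inter_subset_left)
      fun _ hz => ⟨(extChartAt (𝓡 n) x).map_target hz.1, hz.2⟩

end SmoothFields

section Metric

variable {n : ℕ} {M : Type*} [TopologicalSpace M] [ChartedSpace (EuclideanSpace ℝ (Fin n)) M]
  [RiemannianBundle (fun x : M => TangentSpace (𝓡 n) x)]

theorem metricInChart_apply (x : M) (z a b : Model n) :
    metricInChart x z a b = inner ℝ (ofModel x z a) (ofModel x z b) := rfl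

theorem metricInChart_symm (x : M) (z a b : Model n) :
    metricInChart x z a b = metricInChart x z b a := by
  rw [metricInChart_apply, metricInChart_apply, real_inner_comm]

theorem flat_apply (A : VField n M) (x : M) (v : Fin 1 → TangentSpace (𝓡 n) x) :
    flat A x v = inner ℝ (A x) (v 0) := rfl

theorem inner_sharpField (α : DForm n M 1) (x : M) (v : TangentSpace (𝓡 n) x) :
    inner ℝ (sharpField α x) v = α x fun _ => v :=
  inner_sharp _ v

theorem flat_sharpField (α : DForm n M 1) : flat (sharpField α) = α := by
  funext x
  ext v
  rw [flat_apply, inner_sharpField]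
  exact congrArg (α x) (funext fun i => congrArg v (Subsingleton.elim 0 i))

theorem flat_add (A B : VField n M) : flat (A + B) = flat A + flat B := by
  funext x
  ext v
  exact inner_add_left (A x) (B x) (v 0)

theorem flat_smul (c : ℝ) (A : VField n M) : flat (c • A) = c • flat A := by
  funext x
  ext v
  exact real_inner_smul_left (A x) (v 0) c

variable [IsManifold (𝓡 n) ∞ M]

theorem metricInChart_toModel (x : M) {z : Model n} (hz : z ∈ (extChartAt (𝓡 n) x).target)
    (v w : TangentSpace (𝓡 n) ((extChartAt (𝓡 n) x).symm z)) :
    metricInChart x z (toModel x _ v) (toModel x _ w) = inner ℝ v w := by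
  rw [metricInChart_apply, ofModel_toModel x hz, ofModel_toModel x hz]

theorem metricInChart_fieldInChart (Y : VField n M) (x : M) {z : Model n}
    (hz : z ∈ (extChartAt (𝓡 n) x).target) (a : Model n) :
    metricInChart x z (fieldInChart Y x z) a
      = inner ℝ (Y ((extChartAt (𝓡 n) x).symm z)) (ofModel x z a) := by
  rw [metricInChart_apply, ofModel_fieldInChart Y x hz]

theorem formInChart_flat (Y : VField n M) (x : M) {z : Model n}
    (hz : z ∈ (extChartAt (𝓡 n) x).target) (v : Fin 1 → Model n) :
    formInChart (flat Y) x z v = metricInChart x z (fieldInChart Y x z) (v 0) := by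
  rw [metricInChart_fieldInChart Y x hz]
  rfl

theorem exists_metricInChart_equiv (x : M) {z : Model n}
    (hz : z ∈ (extChartAt (𝓡 n) x).target) :
    ∃ e : Model n ≃L[ℝ] (Model n →L[ℝ] ℝ),
      (e : Model n →L[ℝ] Model n →L[ℝ] ℝ) = metricInChart x z := by
  have hinj : Function.Injective (metricInChart x z) := by
    refine (injective_iff_map_eq_zero _).2 fun a ha => ?_
    have hself : metricInChart x z a a = 0 := by rw [ha]; rfl
    rw [metricInChart_apply, inner_self_eq_zero] at hself
    rw [← toModel_ofModel x hz a, hself, map_zero]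
  have hfinrank : finrank ℝ (Model n) = finrank ℝ (Model n →L[ℝ] ℝ) := by
    rw [← LinearEquiv.finrank_eq
      (LinearMap.toContinuousLinearMap : (Model n →ₗ[ℝ] ℝ) ≃ₗ[ℝ] (Model n →L[ℝ] ℝ)),
      Module.finrank_linearMap, finrank_self, mul_one]
  exact ⟨(LinearEquiv.ofInjectiveOfFinrankEq (metricInChart x z).toLinearMap hinj
    hfinrank).toContinuousLinearEquiv, rfl⟩

theorem inverse_metricInChart_apply (x : M) {z : Model n}
    (hz : z ∈ (extChartAt (𝓡 n) x).target) (a : Model n) :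
    (metricInChart x z).inverse (metricInChart x z a) = a := by
  obtain ⟨e, he⟩ := exists_metricInChart_equiv x hz
  rw [← he, ContinuousLinearMap.inverse_equiv]
  exact e.symm_apply_apply a

theorem sum_metricInChart_smul_inverse_proj (x : M) {z : Model n}
    (hz : z ∈ (extChartAt (𝓡 n) x).target) (a : Model n) :
    ∑ j, metricInChart x z (EuclideanSpace.basisFun (Fin n) ℝ j) a
      • (metricInChart x z).inverse (EuclideanSpace.proj j) = a := by
  have hexpand : ∑ j, metricInChart x z (EuclideanSpace.basisFun (Fin n) ℝ j) a
      • (EuclideanSpace.proj j : Model n →L[ℝ] ℝ) = metricInChart x z a := by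
    ext b
    conv_rhs => rw [← (EuclideanSpace.basisFun (Fin n) ℝ).sum_repr b]
    simp only [sum_apply, smul_apply, map_sum, map_smul,
      EuclideanSpace.basisFun_repr, PiLp.proj_apply, smul_eq_mul, metricInChart_symm x z a,
      mul_comm]
  calc _ = (metricInChart x z).inverse (∑ j, metricInChart x z
        (EuclideanSpace.basisFun (Fin n) ℝ j) a • EuclideanSpace.proj j) := by
        simp only [map_sum, map_smul]
    _ = a := by rw [hexpand, inverse_metricInChart_apply x hz]

variable [IsContMDiffRiemannianBundle (𝓡 n) ∞ (EuclideanSpace ℝ (Fin n))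
      (fun x : M => TangentSpace (𝓡 n) x)]

theorem contDiffOn_metricInChart (x : M) :
    ContDiffOn ℝ ∞ (metricInChart x) (extChartAt (𝓡 n) x).target := by
  refine contDiffOn_clm_apply.2 fun a => contDiffOn_clm_apply.2 fun b => ?_
  rw [← contMDiffOn_iff_contDiffOn]
  exact (contMDiffOn_ofModel x a).inner_bundle (contMDiffOn_ofModel x b)

theorem contDiffAt_metricInChart (x : M) :
    ContDiffAt ℝ ∞ (metricInChart x) (extChartAt (𝓡 n) x x) :=
  (contDiffOn_metricInChart x).contDiffAt (extChartAt_target_mem_nhds x)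

theorem contDiffOn_inverse_metricInChart (x : M) :
    ContDiffOn ℝ ∞ (fun z => (metricInChart x z).inverse) (extChartAt (𝓡 n) x).target :=
  fun z hz => by
    obtain ⟨e, he⟩ := exists_metricInChart_equiv x hz
    have hinverse := contDiffAt_map_inverse (n := ∞) e
    rw [he] at hinverse
    exact hinverse.comp_contDiffWithinAt z (contDiffOn_metricInChart x z hz)

theorem SmoothField.flat {Y : VField n M} (hY : SmoothField Y) : SmoothForm (flat Y) := fun x =>
  contDiffOn_alternating_iff.2 fun v => ContDiffOn.congr
    (((contDiffOn_metricInChart x).clm_apply (hY x)).clm_apply contDiffOn_const)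
    fun _ hz => formInChart_flat Y x hz v

theorem SmoothForm.sharpField {α : DForm n M 1} (hα : SmoothForm α) :
    SmoothField (sharpField α) := fun x => by
  let A : Model n → Model n →L[ℝ] ℝ := fun z =>
    (ContinuousAlternatingMap.ofSubsingleton ℝ (Model n) ℝ (0 : Fin 1)).symm (formInChart α x z)
  have hA : ContDiffOn ℝ ∞ A (extChartAt (𝓡 n) x).target :=
    contDiffOn_clm_apply.2 fun a => contDiffOn_alternating_iff.1 (hα x) fun _ => a
  refine ((contDiffOn_inverse_metricInChart x).clm_apply hA).congr fun z hz => ?_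
  have hflat : metricInChart x z (fieldInChart (NSVorticity.sharpField α) x z) = A z := by
    ext a
    rw [metricInChart_fieldInChart _ x hz, inner_sharpField]
    rfl
  rw [← hflat, inverse_metricInChart_apply x hz]

end Metric

section InteriorProduct

variable {n p : ℕ} {M : Type*} [TopologicalSpace M] [ChartedSpace (EuclideanSpace ℝ (Fin n)) M]
  [RiemannianBundle (fun x : M => TangentSpace (𝓡 n) x)]

/-- The interior product `ι_Y α`, which feeds `Y` to the first argument of `α`. -/
def interiorProd (Y : VField n M) (α : DForm n M (p + 1)) : DForm n M p :=
  fun x => (α x).curryLeft (Y x)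

theorem interiorProd_apply (Y : VField n M) (α : DForm n M (p + 1)) (x : M)
    (v : Fin p → TangentSpace (𝓡 n) x) :
    interiorProd Y α x v = α x (Matrix.vecCons (Y x) v) := rfl

theorem interiorProd_interiorProd_self (Y : VField n M) (α : DForm n M (p + 2)) :
    interiorProd Y (interiorProd Y α) = 0 :=
  funext fun x => (α x).curryLeft_same (Y x)

variable [IsManifold (𝓡 n) ∞ M]

theorem formInChart_interiorProd (Y : VField n M) (α : DForm n M (p + 1)) (x : M) {z : Model n}
    (hz : z ∈ (extChartAt (𝓡 n) x).target) :
    formInChart (interiorProd Y α) x z = (formInChart α x z).curryLeft (fieldInChart Y x z) := by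
  rw [formInChart, formInChart, ContinuousAlternatingMap.curryLeft_compContinuousLinearMap,
    ofModel_fieldInChart Y x hz]
  rfl

theorem SmoothForm.interiorProd {Y : VField n M} {α : DForm n M (p + 1)} (hY : SmoothField Y)
    (hα : SmoothForm α) : SmoothForm (interiorProd Y α) := fun x =>
  contDiffOn_alternating_iff.2 fun v => by
    refine (contDiffOn_alternatingMap_apply (v := fun z => Matrix.vecCons (fieldInChart Y x z) v)
      (hα x) fun i => ?_).congr fun z hz => ?_
    · exact Fin.cases (hY x) (fun _ => contDiffOn_const) i
    · rw [formInChart_interiorProd Y α x hz]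
      rfl

end InteriorProduct

section VolumeForm

variable {n p q : ℕ} {M : Type*} [TopologicalSpace M] [ChartedSpace (EuclideanSpace ℝ (Fin n)) M]
  [IsManifold (𝓡 n) ∞ M] [RiemannianBundle (fun x : M => TangentSpace (𝓡 n) x)]

/-- The Riemannian volume form of an oriented manifold. -/
def volForm (o : MOrientation n M) : DForm n M n := fun x => contVolumeForm (o.orient x)

theorem formInChart_volForm_sq (o : MOrientation n M) (x : M) (z : Model n) (v : Fin n → Model n) :
    formInChart (volForm o) x z v ^ 2
      = (Matrix.of fun i j => metricInChart x z (v i) (v j)).det :=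
  volumeForm_sq _ _

theorem exists_local_positive_frame (o : MOrientation n M) (x : M) {z : Model n}
    (hz : z ∈ (extChartAt (𝓡 n) x).target) :
    ∃ s ∈ 𝓝 z, s ⊆ (extChartAt (𝓡 n) x).target ∧ ∃ X : Model n → Fin n → Model n,
      (∀ i, ContDiffOn ℝ ∞ (fun z' => X z' i) s) ∧
        ∀ z' ∈ s, 0 < formInChart (volForm o) x z' (X z') := by
  obtain ⟨U, hU, Y, hY, hframe⟩ := o.exists_frame ((extChartAt (𝓡 n) x).symm z)
  have hcont : ContinuousAt (extChartAt (𝓡 n) x).symm z := continuousAt_extChartAt_symm'' hz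
  refine ⟨(extChartAt (𝓡 n) x).target ∩ (extChartAt (𝓡 n) x).symm ⁻¹' U,
    Filter.inter_mem ((isOpen_target x).mem_nhds hz) (hcont.preimage_mem_nhds hU),
    Set.inter_subset_left, fun z' i => fieldInChart (Y i) x z',
    fun i => contDiffOn_fieldInChart (hY i) x, fun z' hz' => ?_⟩
  obtain ⟨b, hbY, hb⟩ := hframe _ hz'.2
  have hframe_eq : (fun i => ofModel x z' (fieldInChart (Y i) x z')) = b :=
    funext fun i => (ofModel_fieldInChart (Y i) x hz'.1).trans (hbY i).symm
  change 0 < (o.orient _).volumeForm fun i => ofModel x z' (fieldInChart (Y i) x z')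
  rw [hframe_eq]
  exact volumeForm_pos _ b hb

theorem formInChart_star_apply (o : MOrientation n M) (h : p + q = n) (α : DForm n M p) (x : M)
    {z : Model n} (hz : z ∈ (extChartAt (𝓡 n) x).target) (v : Fin q → Model n) :
    formInChart (star o h α) x z v = (p.factorial : ℝ)⁻¹ * ∑ f : Fin p → Fin n,
      formInChart α x z (fun k => (metricInChart x z).inverse (EuclideanSpace.proj (f k)))
        * formInChart (volForm o) x z
          (Fin.append (EuclideanSpace.basisFun (Fin n) ℝ ∘ f) v ∘ Fin.cast h.symm) := by
  have hdual : ∀ w : TangentSpace (𝓡 n) ((extChartAt (𝓡 n) x).symm z),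
      ∑ j, inner ℝ (ofModel x z (EuclideanSpace.basisFun (Fin n) ℝ j)) w
        • ofModel x z ((metricInChart x z).inverse (EuclideanSpace.proj j)) = w := fun w => by
    have hsum := congrArg (ofModel x z) (sum_metricInChart_smul_inverse_proj x hz (toModel x _ w))
    simpa only [map_sum, map_smul, metricInChart_apply, ofModel_toModel x hz] using hsum
  refine (hodgeStar_apply_of_dual _ h hdual _ _).trans <| congrArg _ <|
    Finset.sum_congr rfl fun f _ => congrArg _ <| congrArg (o.orient _).volumeForm ?_
  exact congrArg (· ∘ Fin.cast h.symm)
    (append_comp (ofModel x z) (EuclideanSpace.basisFun (Fin n) ℝ ∘ f) v)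

variable [IsContMDiffRiemannianBundle (𝓡 n) ∞ (EuclideanSpace ℝ (Fin n))
      (fun x : M => TangentSpace (𝓡 n) x)]

theorem smoothForm_volForm (o : MOrientation n M) : SmoothForm (volForm o) := fun x z hz => by
  obtain ⟨s, hs, hst, X, hX, hpos⟩ := exists_local_positive_frame o x hz
  let G : Model n → Matrix (Fin n) (Fin n) ℝ := fun z' =>
    Matrix.of fun i j => metricInChart x z' (X z' i) (X z' j)
  have hsq : ∀ z', (G z').det = formInChart (volForm o) x z' (X z') ^ 2 := fun z' =>
    (formInChart_volForm_sq o x z' (X z')).symm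
  have hmetric := (contDiffOn_metricInChart x).mono hst
  have hentry : ∀ i j, ContDiffOn ℝ ∞ (fun z' => metricInChart x z' (X z' i) (X z' j)) s :=
    fun i j => (hmetric.clm_apply (hX i)).clm_apply (hX j)
  have hG : ContDiffOn ℝ ∞ (fun z' => (G z').det) s := contDiffOn_det hentry
  have hG0 : ∀ z' ∈ s, (G z').det ≠ 0 := fun z' hz' => by
    rw [hsq]
    exact pow_ne_zero 2 (hpos z' hz').ne'
  have hval : ContDiffOn ℝ ∞ (fun z' => formInChart (volForm o) x z' (X z')) s :=
    (hG.sqrt hG0).congr fun z' hz' => by rw [hsq, Real.sqrt_sq (hpos z' hz').le]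
  have hsmooth : ContDiffOn ℝ ∞ (formInChart (volForm o) x) s :=
    contDiffOn_of_apply_frame (EuclideanSpace.basisFun (Fin n) ℝ).toBasis hX hval
      fun z' hz' => (hpos z' hz').ne'
  exact (hsmooth.contDiffAt hs).contDiffWithinAt

theorem SmoothForm.star {α : DForm n M p} (hα : SmoothForm α) (o : MOrientation n M)
    (h : p + q = n) : SmoothForm (star o h α) := fun x => contDiffOn_alternating_iff.2 fun v =>
  (contDiffOn_const.mul <| ContDiffOn.sum fun _ _ =>
    (contDiffOn_alternatingMap_apply (hα x) fun _ =>
      (contDiffOn_inverse_metricInChart x).clm_apply contDiffOn_const).mul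
      (contDiffOn_alternating_iff.1 (smoothForm_volForm o x) _)).congr
    fun _ hz => formInChart_star_apply o h α x hz v

end VolumeForm

section StarVolumeForm

theorem contVolumeForm_ne_zero {n : ℕ} {V : Type*} [NormedAddCommGroup V] [InnerProductSpace ℝ V]
    [FiniteDimensional ℝ V] [Fact (finrank ℝ V = n)] (o : Orientation ℝ V (Fin n)) :
    contVolumeForm o ≠ 0 := fun h => by
  let b := (stdOrthonormalBasis ℝ V).reindex (finCongr (Fact.out : finrank ℝ V = n))
  have hb : |contVolumeForm o b| = 1 := o.abs_volumeForm_apply_of_orthonormal b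
  simp [h] at hb

variable {n p q : ℕ} {M : Type*} [TopologicalSpace M]

section General

variable [ChartedSpace (EuclideanSpace ℝ (Fin n)) M]
  [IsManifold (𝓡 n) ∞ M] [RiemannianBundle (fun x : M => TangentSpace (𝓡 n) x)]

theorem star_add (o : MOrientation n M) (h : p + q = n) (α β : DForm n M p) :
    star o h (α + β) = star o h α + star o h β := by
  funext x
  simp [star, hodgeStar, add_smul, Finset.sum_add_distrib]

theorem star_smul (o : MOrientation n M) (h : p + q = n) (c : ℝ) (α : DForm n M p) :
    star o h (c • α) = c • star o h α := by
  funext x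
  simp [star, hodgeStar, mul_smul, Finset.smul_sum, smul_comm c]

theorem star_zero (o : MOrientation n M) (h : p + q = n) :
    star o h (0 : DForm n M p) = 0 := by
  rw [← zero_smul ℝ (0 : DForm n M p), star_smul, zero_smul]

variable [IsContMDiffRiemannianBundle (𝓡 n) ∞ (EuclideanSpace ℝ (Fin n))
      (fun x : M => TangentSpace (𝓡 n) x)]

theorem SmoothForm.codiff {α : DForm n M (p + 1)} (hα : SmoothForm α) (o : MOrientation n M)
    (h : (p + 1) + q = n) : SmoothForm (codiff o h α) :=
  (((hα.star o h).extD).star o _).smul _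

theorem SmoothForm.hodgeLaplacian {α : DForm n M (p + 1)} (hα : SmoothForm α)
    (o : MOrientation n M) (h : (p + 1) + (q + 1) = n) : SmoothForm (hodgeLaplacian o h α) :=
  (hα.codiff o h).extD.add (hα.extD.codiff o _)

end General

theorem star_flat [ChartedSpace (EuclideanSpace ℝ (Fin (q + 1))) M] [IsManifold (𝓡 (q + 1)) ∞ M]
    [RiemannianBundle (fun x : M => TangentSpace (𝓡 (q + 1)) x)] (o : MOrientation (q + 1) M)
    (h : 1 + q = q + 1) (Y : VField (q + 1) M) :
    star o h (flat Y) = interiorProd Y (volForm o) :=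
  funext fun x => hodgeStar_ofSubsingleton (o.orient x) h (Y x)

variable [ChartedSpace (EuclideanSpace ℝ (Fin 3)) M] [IsManifold (𝓡 3) ∞ M]
  [RiemannianBundle (fun x : M => TangentSpace (𝓡 3) x)]

theorem star_interiorProd_volForm (o : MOrientation 3 M) (h : 2 + 1 = 3) (Y : VField 3 M) :
    star o h (interiorProd Y (volForm o)) = flat Y :=
  funext fun x => hodgeStar_curryLeft_volumeForm (o.orient x) h (Y x)

theorem star_star_two (o : MOrientation 3 M) (h : 1 + 2 = 3) (h' : 2 + 1 = 3) (β : DForm 3 M 2) :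
    star o h (star o h' β) = β := by
  have hcontract : ∀ x, ∃ w : TangentSpace (𝓡 3) x,
      (contVolumeForm (o.orient x)).curryLeft w = β x := fun x =>
    exists_curryLeft_eq Fact.out (contVolumeForm_ne_zero (o.orient x)) (β x)
  choose Y hY using hcontract
  obtain rfl : interiorProd Y (volForm o) = β := funext hY
  rw [star_interiorProd_volForm, star_flat]

theorem interiorProd_sharpField_star (o : MOrientation 3 M) (h : 2 + 1 = 3) (β : DForm 3 M 2) :
    interiorProd (sharpField (star o h β)) (volForm o) = β := by
  rw [← star_flat o rfl, flat_sharpField, star_star_two]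

theorem codiff_two_eq_star_extD_star (o : MOrientation 3 M) (h : (1 + 1) + 1 = 3)
    (β : DForm 3 M 2) : codiff o h β = star o h (extD (star o h β)) := by
  rw [codiff, Even.neg_one_pow (by decide), one_smul]

variable [IsContMDiffRiemannianBundle (𝓡 3) ∞ (EuclideanSpace ℝ (Fin 3))
      (fun x : M => TangentSpace (𝓡 3) x)]

theorem laplacianForm_star_extD {α : DForm 3 M 1} (hα : SmoothForm α) (o : MOrientation 3 M)
    (h : 2 + 1 = 3) :
    laplacianForm o (star o h (extD α)) = star o h (extD (laplacianForm o α)) := by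
  have hcoclosed : codiff o (p := 0) (q := 2) rfl (star o h (extD α)) = 0 := by
    rw [codiff, star_star_two, extD_extD hα, star_zero, smul_zero]
  calc laplacianForm o (star o h (extD α))
      = codiff o (p := 1) (q := 1) rfl (extD (star o h (extD α))) := by
        rw [laplacianForm, hodgeLaplacian, hcoclosed, extD_zero, zero_add]
    _ = star o h (extD (codiff o (p := 1) (q := 1) rfl (extD α))) := by
        rw [codiff_two_eq_star_extD_star, codiff_two_eq_star_extD_star]
    _ = star o h (extD (laplacianForm o α)) := by
        rw [laplacianForm, hodgeLaplacian, extD_add (hα.codiff o _).extD (hα.extD.codiff o _),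
          extD_extD (hα.codiff o _), zero_add]

end StarVolumeForm

section InsertEndo

variable {V : Type*} [NormedAddCommGroup V] [NormedSpace ℝ V] {p : ℕ}

theorem insertEndo_apply (β : V [⋀^Fin p]→L[ℝ] ℝ) (T : V →L[ℝ] V) (v : Fin p → V) :
    insertEndo β T v = ∑ i, β (Function.update v i (T (v i))) := rfl

theorem insertEndo_vecCons (β : V [⋀^Fin (p + 1)]→L[ℝ] ℝ) (T : V →L[ℝ] V) (a : V)
    (v : Fin p → V) :
    insertEndo β T (Matrix.vecCons a v)
      = β (Matrix.vecCons (T a) v) + insertEndo (β.curryLeft a) T v := by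
  rw [insertEndo_apply, Fin.sum_univ_succ, insertEndo_apply]
  simp only [Matrix.vecCons, Fin.cons_zero, Fin.cons_succ, Fin.update_cons_zero,
    ← Fin.cons_update]
  rfl

theorem insertEndo_eq_fderivCompContinuousLinearMap (β : V [⋀^Fin p]→L[ℝ] ℝ) (T : V →L[ℝ] V) :
    insertEndo β T = β.fderivCompContinuousLinearMap (.id ℝ V) T := by
  ext v
  rw [insertEndo_apply, ContinuousAlternatingMap.fderivCompContinuousLinearMap_apply]
  refine Finset.sum_congr rfl fun i _ => congrArg β (funext fun j => ?_)
  obtain rfl | hj := eq_or_ne j i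
  · simp only [Function.update_self]
  · simp only [Function.update_of_ne hj, ContinuousLinearMap.id_apply]

theorem insertEndo_eq_sum_vecCons_removeNth (β : V [⋀^Fin (p + 1)]→L[ℝ] ℝ) (T : V →L[ℝ] V)
    (v : Fin (p + 1) → V) :
    insertEndo β T v = ∑ i : Fin (p + 1),
      (-1 : ℝ) ^ (i : ℕ) * β (Matrix.vecCons (T (v i)) (i.removeNth v)) := by
  refine (insertEndo_apply β T v).trans <| Finset.sum_congr rfl fun i _ => ?_
  have hinsert := β.toAlternatingMap.map_insertNth i (T (v i)) (i.removeNth v)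
  rw [Fin.insertNth_removeNth] at hinsert
  simpa using hinsert

theorem sum_insertEndo_removeNth_eq_zero [FiniteDimensional ℝ V] (β : V [⋀^Fin p]→L[ℝ] ℝ)
    {Γ : V → V →L[ℝ] V} (hΓ : ∀ a b, Γ a b = Γ b a) (v : Fin (p + 1) → V) :
    ∑ i : Fin (p + 1), (-1 : ℝ) ^ (i : ℕ) * insertEndo β (Γ (v i)) (i.removeNth v) = 0 := by
  let Γ' : V →ₗ[ℝ] V →L[ℝ] V :=
    { toFun := Γ
      map_add' := fun a b => by
        ext c
        rw [add_apply, hΓ, map_add, hΓ c, hΓ c]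
      map_smul' := fun r a => by
        ext c
        rw [RingHom.id_apply, smul_apply, hΓ, map_smul, hΓ c] }
  have hzero := ContinuousAlternatingMap.alternatizeUncurryFin_fderivCompContinuousLinearMap_eq_zero
    β (.id ℝ V) (h := LinearMap.toContinuousLinearMap Γ') hΓ
  have hv := DFunLike.congr_fun hzero v
  rw [ContinuousAlternatingMap.alternatizeUncurryFin_apply] at hv
  simp only [zsmul_eq_mul, Int.cast_pow, Int.cast_neg, Int.cast_one] at hv
  simp only [insertEndo_eq_fderivCompContinuousLinearMap]
  exact hv

end InsertEndo

theorem fderiv_curryLeft {D E : Type*} [NormedAddCommGroup D] [NormedSpace ℝ D]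
    [NormedAddCommGroup E] [NormedSpace ℝ E] {p : ℕ} {η : D → E [⋀^Fin (p + 1)]→L[ℝ] ℝ}
    {Y : D → E} {z : D} (hη : DifferentiableAt ℝ η z) (hY : DifferentiableAt ℝ Y z) (a : D) :
    fderiv ℝ (fun z => (η z).curryLeft (Y z)) z a
      = (fderiv ℝ η z a).curryLeft (Y z) + (η z).curryLeft (fderiv ℝ Y z a) := by
  let C := (ContinuousAlternatingMap.curryLeftLI (𝕜 := ℝ) (E := E) (F := ℝ)
    (n := p)).toContinuousLinearMap
  have hC : HasFDerivAt (fun z => C (η z)) (C ∘L fderiv ℝ η z) z :=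
    HasFDerivAt.comp (G := E →L[ℝ] E [⋀^Fin p]→L[ℝ] ℝ) z C.hasFDerivAt hη.hasFDerivAt
  refine (DFunLike.congr_fun (hC.clm_apply hY.hasFDerivAt).fderiv a).trans ?_
  rw [add_comm]
  rfl

section Connection

variable {n p : ℕ} {M : Type*} [TopologicalSpace M] [ChartedSpace (EuclideanSpace ℝ (Fin n)) M]

theorem fieldInChart_self (Y : VField n M) (x : M) :
    fieldInChart Y x (extChartAt (𝓡 n) x x) = toModel x x (Y x) := by
  rw [fieldInChart, extChartAt_to_inv]

variable [RiemannianBundle (fun x : M => TangentSpace (𝓡 n) x)]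

theorem inner_christoffel (x : M) (a b c : TangentSpace (𝓡 n) x) :
    inner ℝ (christoffel x b a) c = 2⁻¹ *
      (fderiv ℝ (metricInChart x) (extChartAt (𝓡 n) x x) (toModel x x a) (toModel x x b)
          (toModel x x c)
        + fderiv ℝ (metricInChart x) (extChartAt (𝓡 n) x x) (toModel x x b) (toModel x x a)
          (toModel x x c)
        - fderiv ℝ (metricInChart x) (extChartAt (𝓡 n) x x) (toModel x x c) (toModel x x b)
          (toModel x x a)) :=
  inner_sharp _ _

theorem covForm_apply (α : DForm n M p) (x : M) (a : TangentSpace (𝓡 n) x)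
    (v : Fin p → TangentSpace (𝓡 n) x) :
    covForm α x a v = fderiv ℝ (formInChart α x) (extChartAt (𝓡 n) x x) (toModel x x a)
      (fun i => toModel x x (v i)) - insertEndo (α x) (christoffel x a) v := rfl

variable [IsManifold (𝓡 n) ∞ M]

theorem toModel_leviCivita (Y : VField n M) (x : M) (v : TangentSpace (𝓡 n) x) :
    toModel x x (leviCivita Y x v) = fderiv ℝ (fieldInChart Y x) (extChartAt (𝓡 n) x x)
      (toModel x x v) + toModel x x (christoffel x (Y x) v) := by
  have hinv : (toModel (n := n) x x).IsInvertible :=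
    isInvertible_mfderiv_extChartAt (I := 𝓡 n) (mem_extChartAt_source x)
  rw [leviCivita, add_apply, map_add]
  exact congrArg (· + _) (DFunLike.congr_fun hinv.self_comp_inverse _)

theorem metricInChart_self (x : M) (v w : TangentSpace (𝓡 n) x) :
    metricInChart x (extChartAt (𝓡 n) x x) (toModel x x v) (toModel x x w) = inner ℝ v w := by
  have h := metricInChart_toModel x (mem_extChartAt_target (I := 𝓡 n) x)
  rw [extChartAt_to_inv] at h
  exact h v w

theorem fderiv_formInChart_interiorProd {α : DForm n M (p + 1)} {Y : VField n M}
    (hα : SmoothForm α) (hY : SmoothField Y) (x : M) (a : Model n) :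
    fderiv ℝ (formInChart (interiorProd Y α) x) (extChartAt (𝓡 n) x x) a
      = (fderiv ℝ (formInChart α x) (extChartAt (𝓡 n) x x) a).curryLeft (toModel x x (Y x))
        + (formInChart α x (extChartAt (𝓡 n) x x)).curryLeft
          (fderiv ℝ (fieldInChart Y x) (extChartAt (𝓡 n) x x) a) := by
  have heq : formInChart (interiorProd Y α) x =ᶠ[𝓝 (extChartAt (𝓡 n) x x)]
      fun z => (formInChart α x z).curryLeft (fieldInChart Y x z) := by
    filter_upwards [extChartAt_target_mem_nhds x] with z hz
    exact formInChart_interiorProd Y α x hz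
  rw [heq.fderiv_eq, fderiv_curryLeft (hα.differentiableAt x) (hY.differentiableAt x),
    fieldInChart_self]

variable [IsContMDiffRiemannianBundle (𝓡 n) ∞ (EuclideanSpace ℝ (Fin n))
      (fun x : M => TangentSpace (𝓡 n) x)]

theorem differentiableAt_metricInChart (x : M) :
    DifferentiableAt ℝ (metricInChart (n := n) x) (extChartAt (𝓡 n) x x) :=
  (contDiffAt_metricInChart x).differentiableAt (by simp)

theorem fderiv_metricInChart_apply (x : M) (a b c : Model n) :
    fderiv ℝ (metricInChart x) (extChartAt (𝓡 n) x x) a b c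
      = fderiv ℝ (fun z => metricInChart x z b c) (extChartAt (𝓡 n) x x) a := by
  have hg := differentiableAt_metricInChart (n := n) x
  rw [fderiv_clm_apply (hg.clm_apply (differentiableAt_const b)) (differentiableAt_const c),
    fderiv_clm_apply hg (differentiableAt_const b)]
  simp

theorem fderiv_metricInChart_symm (x : M) (a b c : Model n) :
    fderiv ℝ (metricInChart x) (extChartAt (𝓡 n) x x) a b c
      = fderiv ℝ (metricInChart x) (extChartAt (𝓡 n) x x) a c b := by
  simp only [fderiv_metricInChart_apply, metricInChart_symm x _ b c]

theorem christoffel_symm (x : M) (a b : TangentSpace (𝓡 n) x) :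
    christoffel x a b = christoffel x b a := by
  refine ext_inner_right ℝ fun c => ?_
  rw [inner_christoffel, inner_christoffel, fderiv_metricInChart_symm x (toModel x x c)]
  ring

theorem fderiv_metricInChart_eq (x : M) (a b c : TangentSpace (𝓡 n) x) :
    fderiv ℝ (metricInChart x) (extChartAt (𝓡 n) x x) (toModel x x a) (toModel x x b)
        (toModel x x c)
      = inner ℝ (christoffel x a b) c + inner ℝ b (christoffel x a c) := by
  rw [real_inner_comm _ b, inner_christoffel, inner_christoffel,
    fderiv_metricInChart_symm x _ (toModel x x c) (toModel x x b),
    fderiv_metricInChart_symm x (toModel x x c),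
    fderiv_metricInChart_symm x (toModel x x b)]
  ring

/-- The connection is torsion-free, so its Christoffel terms cancel in the alternating sum. -/
theorem extD_apply_eq_sum_covForm (α : DForm n M p) (x : M)
    (v : Fin (p + 1) → TangentSpace (𝓡 n) x) :
    extD α x v
      = ∑ i : Fin (p + 1), (-1 : ℝ) ^ (i : ℕ) * covForm α x (v i) (i.removeNth v) := by
  have hextD : extD α x v = ∑ i : Fin (p + 1), (-1 : ℝ) ^ (i : ℕ) *
      fderiv ℝ (formInChart α x) (extChartAt (𝓡 n) x x) (toModel x x (v i))
        (fun j => toModel x x (i.removeNth v j)) := by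
    rw [extD, extDeriv, ContinuousAlternatingMap.compContinuousLinearMap_apply,
      ContinuousAlternatingMap.alternatizeUncurryFin_apply]
    simp only [zsmul_eq_mul, Int.cast_pow, Int.cast_neg, Int.cast_one]
    rfl
  simp only [covForm_apply, mul_sub, Finset.sum_sub_distrib, hextD,
    sum_insertEndo_removeNth_eq_zero (α x) (christoffel_symm x), sub_zero]

theorem covForm_interiorProd {α : DForm n M (p + 1)} {Y : VField n M} (hα : SmoothForm α)
    (hY : SmoothField Y) (x : M) (a : TangentSpace (𝓡 n) x) :
    covForm (interiorProd Y α) x a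
      = (covForm α x a).curryLeft (Y x) + (α x).curryLeft (leviCivita Y x a) := by
  ext v
  have hcons : ∀ b : TangentSpace (𝓡 n) x,
      (fun i => toModel x x ((Matrix.vecCons b v : Fin (p + 1) → TangentSpace (𝓡 n) x) i))
        = Matrix.vecCons (toModel x x b) fun i => toModel x x (v i) := fun b =>
    funext <| Fin.cases rfl fun _ => rfl
  have hα_cons : ∀ b : TangentSpace (𝓡 n) x, α x (Matrix.vecCons b v)
      = formInChart α x (extChartAt (𝓡 n) x x)
        (Matrix.vecCons (toModel x x b) fun i => toModel x x (v i)) := fun b => by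
    rw [← hcons, ← formInChart_comp_toModel α x (mem_extChartAt_source x)]
    rfl
  have hLeviCivita : α x (Matrix.vecCons (leviCivita Y x a) v)
      = formInChart α x (extChartAt (𝓡 n) x x) (Matrix.vecCons
        (fderiv ℝ (fieldInChart Y x) (extChartAt (𝓡 n) x x) (toModel x x a))
          fun i => toModel x x (v i))
        + α x (Matrix.vecCons (christoffel x a (Y x)) v) := by
    have hadd := (formInChart α x (extChartAt (𝓡 n) x x)).toAlternatingMap.map_vecCons_add
      (fun i => toModel x x (v i))
      (fderiv ℝ (fieldInChart Y x) (extChartAt (𝓡 n) x x) (toModel x x a))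
      (toModel x x (christoffel x (Y x) a))
    rw [hα_cons, toModel_leviCivita, christoffel_symm x a, hα_cons]
    exact hadd
  rw [covForm_apply, fderiv_formInChart_interiorProd hα hY]
  simp only [ContinuousAlternatingMap.add_apply, ContinuousAlternatingMap.curryLeft_apply_apply]
  rw [covForm_apply, insertEndo_vecCons, hLeviCivita, hcons]
  simp only [interiorProd]
  ring

theorem covForm_flat_apply {Y : VField n M} (hY : SmoothField Y) (x : M)
    (a : TangentSpace (𝓡 n) x) (v : Fin 1 → TangentSpace (𝓡 n) x) :
    covForm (flat Y) x a v = inner ℝ (leviCivita Y x a) (v 0) := by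
  let w : Fin 1 → Model n := fun i => toModel x x (v i)
  have heq : (fun z => formInChart (flat Y) x z w) =ᶠ[𝓝 (extChartAt (𝓡 n) x x)]
      fun z => metricInChart x z (fieldInChart Y x z) (w 0) := by
    filter_upwards [extChartAt_target_mem_nhds x] with z hz
    exact formInChart_flat Y x hz w
  have hgY := (differentiableAt_metricInChart x).clm_apply (hY.differentiableAt x)
  have hproduct : fderiv ℝ (fun z => metricInChart x z (fieldInChart Y x z) (w 0))
      (extChartAt (𝓡 n) x x) (toModel x x a)
      = metricInChart x (extChartAt (𝓡 n) x x)
          (fderiv ℝ (fieldInChart Y x) (extChartAt (𝓡 n) x x) (toModel x x a)) (w 0)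
        + fderiv ℝ (metricInChart x) (extChartAt (𝓡 n) x x) (toModel x x a)
          (toModel x x (Y x)) (w 0) := by
    rw [fderiv_clm_apply hgY (differentiableAt_const _),
      fderiv_clm_apply (differentiableAt_metricInChart x) (hY.differentiableAt x),
      fieldInChart_self]
    simp
  have hderiv : fderiv ℝ (formInChart (flat Y) x) (extChartAt (𝓡 n) x x) (toModel x x a) w
      = inner ℝ (leviCivita Y x a) (v 0) + inner ℝ (Y x) (christoffel x a (v 0)) := by
    rw [← fderiv_continuousAlternatingMap_apply_const_apply (hY.flat.differentiableAt x),
      heq.fderiv_eq, hproduct, fderiv_metricInChart_eq, ← metricInChart_self x (leviCivita Y x a),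
      toModel_leviCivita, map_add, add_apply, metricInChart_self x (christoffel x _ a),
      christoffel_symm x a, add_assoc]
  rw [covForm_apply, hderiv, insertEndo_apply, Fin.sum_univ_one, flat_apply, Function.update_self,
    add_sub_cancel_right]

end Connection

theorem fderiv_det_of_eq_one {D ι : Type*} [NormedAddCommGroup D] [NormedSpace ℝ D] [Fintype ι]
    [DecidableEq ι] {A : D → Matrix ι ι ℝ} {z : D}
    (hA : ∀ i j, DifferentiableAt ℝ (fun z => A z i j) z) (hone : A z = 1) (a : D) :
    fderiv ℝ (fun z => (A z).det) z a = ∑ i, fderiv ℝ (fun z => A z i i) z a := by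
  let f : (ι → ℝ) [⋀^ι]→L[ℝ] ℝ :=
    { Matrix.detRowAlternating with
      cont := continuous_id.matrix_det }
  have hrow : ∀ i, DifferentiableAt ℝ (fun z => A z i) z := fun i => differentiableAt_pi.2 (hA i)
  have hf := fderiv_continuousAlternatingMap_apply_apply (differentiableAt_const f) hrow a
  have hconst : fderiv ℝ (fun _ : D => f) z a = 0 := by simp
  rw [hconst, show (0 : (ι → ℝ) [⋀^ι]→L[ℝ] ℝ) (fun i => A z i) = 0 from rfl, zero_add] at hf
  refine hf.trans <| Finset.sum_congr rfl fun i _ => ?_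
  have hbasis : (fun j => A z j) = Pi.basisFun ℝ ι := by
    rw [hone]
    ext j k
    simp [Matrix.one_apply, Pi.single_apply, eq_comm]
  have hdet : f (Pi.basisFun ℝ ι) = 1 := by
    rw [← hbasis, hone]
    exact Matrix.det_one
  rw [hbasis, fderiv_apply (hrow i) i]
  refine (alternatingMap_update_basis f.toAlternatingMap (Pi.basisFun ℝ ι) i _).trans ?_
  rw [Pi.basisFun_repr]
  exact (congrArg _ hdet).trans (mul_one _)

section VolumeFormParallel

variable {n : ℕ} {M : Type*} [TopologicalSpace M] [ChartedSpace (EuclideanSpace ℝ (Fin n)) M]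
  [IsManifold (𝓡 n) ∞ M] [RiemannianBundle (fun x : M => TangentSpace (𝓡 n) x)]
  [IsContMDiffRiemannianBundle (𝓡 n) ∞ (EuclideanSpace ℝ (Fin n))
      (fun x : M => TangentSpace (𝓡 n) x)]

theorem fderiv_det_metricInChart (x : M) (a : TangentSpace (𝓡 n) x)
    (b : OrthonormalBasis (Fin n) ℝ (TangentSpace (𝓡 n) x)) :
    fderiv ℝ (fun z => (Matrix.of fun i j =>
        metricInChart x z (toModel x x (b i)) (toModel x x (b j))).det)
        (extChartAt (𝓡 n) x x) (toModel x x a)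
      = 2 * LinearMap.trace ℝ _ (christoffel x a).toLinearMap := by
  have hgram : (Matrix.of fun i j => metricInChart x (extChartAt (𝓡 n) x x)
      (toModel x x (b i)) (toModel x x (b j))) = 1 := by
    ext i j
    exact (metricInChart_self x (b i) (b j)).trans
      (((orthonormal_iff_ite (𝕜 := ℝ)).1 b.orthonormal i j).trans (Matrix.one_apply ..).symm)
  have hentry : ∀ v w : Model n, DifferentiableAt ℝ (fun z => metricInChart x z v w)
      (extChartAt (𝓡 n) x x) := fun v w =>
    ((differentiableAt_metricInChart x).clm_apply (differentiableAt_const v)).clm_apply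
      (differentiableAt_const w)
  refine (fderiv_det_of_eq_one (fun i j => hentry (toModel x x (b i)) (toModel x x (b j)))
    hgram _).trans ?_
  rw [LinearMap.trace_eq_sum_inner _ b, Finset.mul_sum]
  refine Finset.sum_congr rfl fun i _ => ?_
  refine (fderiv_metricInChart_apply x _ _ _).symm.trans ?_
  rw [fderiv_metricInChart_eq, real_inner_comm, two_mul]
  rfl

theorem fderiv_formInChart_volForm (o : MOrientation n M) (x : M) (a : TangentSpace (𝓡 n) x)
    (b : OrthonormalBasis (Fin n) ℝ (TangentSpace (𝓡 n) x)) :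
    fderiv ℝ (formInChart (volForm o) x) (extChartAt (𝓡 n) x x) (toModel x x a)
        (fun i => toModel x x (b i))
      = LinearMap.trace ℝ _ (christoffel x a).toLinearMap * volForm o x b := by
  let e : Fin n → Model n := fun i => toModel x x (b i)
  have hvol : formInChart (volForm o) x (extChartAt (𝓡 n) x x) e = volForm o x b :=
    DFunLike.congr_fun (formInChart_comp_toModel (volForm o) x (mem_extChartAt_source x)) ⇑b
  have hvol_sq : volForm o x b ^ 2 = 1 := by
    rw [← sq_abs]
    exact (congrArg (· ^ 2) ((o.orient x).abs_volumeForm_apply_of_orthonormal b)).trans (one_pow 2)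
  have hvol_diff := (smoothForm_volForm o).differentiableAt x
  have hderiv_sq : 2 * volForm o x b
        * fderiv ℝ (formInChart (volForm o) x) (extChartAt (𝓡 n) x x) (toModel x x a) e
      = 2 * LinearMap.trace ℝ _ (christoffel x a).toLinearMap := by
    rw [← fderiv_det_metricInChart x a b, ← funext fun z => formInChart_volForm_sq o x z e,
      fderiv_fun_pow 2 (hvol_diff.continuousAlternatingMap_apply_const e), smul_apply,
      fderiv_continuousAlternatingMap_apply_const_apply hvol_diff, hvol]
    simp
  linear_combination (volForm o x b / 2) * hderiv_sq
    - fderiv ℝ (formInChart (volForm o) x) (extChartAt (𝓡 n) x x) (toModel x x a) e * hvol_sq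

theorem covForm_volForm (o : MOrientation n M) (x : M) (a : TangentSpace (𝓡 n) x) :
    covForm (volForm o) x a = 0 := by
  let b : OrthonormalBasis (Fin n) ℝ (TangentSpace (𝓡 n) x) := (stdOrthonormalBasis ℝ _).reindex
    (finCongr (Fact.out : finrank ℝ (TangentSpace (𝓡 n) x) = n))
  have hb : covForm (volForm o) x a b = 0 := by
    rw [covForm_apply, fderiv_formInChart_volForm, insertEndo_eq_trace_smul Fact.out]
    exact sub_self _
  have hzero := ((covForm (volForm o) x a).toAlternatingMap.map_basis_eq_zero_iff b.toBasis).1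
    ((congrArg _ b.coe_toBasis).trans hb)
  exact ContinuousAlternatingMap.toAlternatingMap_injective hzero

end VolumeFormParallel

theorem insertEndo_curryLeft {V : Type*} [NormedAddCommGroup V] [NormedSpace ℝ V]
    [FiniteDimensional ℝ V] {q : ℕ} (hV : finrank ℝ V = q + 1) (f : V [⋀^Fin (q + 1)]→L[ℝ] ℝ)
    (T : V →L[ℝ] V) (w : V) :
    insertEndo (f.curryLeft w) T
      = LinearMap.trace ℝ V T.toLinearMap • f.curryLeft w - f.curryLeft (T w) := by
  ext v
  have htrace : insertEndo f T (Matrix.vecCons w v) = _ :=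
    DFunLike.congr_fun (insertEndo_eq_trace_smul hV f T) _
  rw [insertEndo_vecCons] at htrace
  exact eq_sub_of_add_eq' htrace

theorem inner_symPart {V : Type*} [NormedAddCommGroup V] [InnerProductSpace ℝ V]
    [FiniteDimensional ℝ V] (T : V →L[ℝ] V) (v w : V) :
    inner ℝ w (symPart T v) = 2⁻¹ * (inner ℝ w (T v) + inner ℝ (T w) v) := by
  have : CompleteSpace V := FiniteDimensional.complete ℝ V
  rw [symPart, smul_apply, add_apply, inner_smul_right, inner_add_right,
    ContinuousLinearMap.adjoint_inner_right]

section Cartan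

variable {n p : ℕ} {M : Type*} [TopologicalSpace M] [ChartedSpace (EuclideanSpace ℝ (Fin n)) M]
  [RiemannianBundle (fun x : M => TangentSpace (𝓡 n) x)]

theorem insertEndo_flat_symGrad (Y Z : VField n M) (x : M)
    (v : Fin 1 → TangentSpace (𝓡 n) x) :
    insertEndo (flat Z x) (symGrad Y x) v
      = 2⁻¹ * (inner ℝ (Z x) (leviCivita Y x (v 0)) + inner ℝ (leviCivita Y x (Z x)) (v 0)) := by
  rw [insertEndo_apply, Fin.sum_univ_one, flat_apply, Function.update_self]
  exact inner_symPart _ _ _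

variable [IsManifold (𝓡 n) ∞ M]
  [IsContMDiffRiemannianBundle (𝓡 n) ∞ (EuclideanSpace ℝ (Fin n))
      (fun x : M => TangentSpace (𝓡 n) x)]

/-- Cartan's formula for the Lie derivative, written with the torsion-free connection. -/
theorem extD_interiorProd_add {β : DForm n M (p + 1)} {Y : VField n M} (hβ : SmoothForm β)
    (hY : SmoothField Y) (x : M) :
    extD (interiorProd Y β) x + (extD β x).curryLeft (Y x)
      = covForm β x (Y x) + insertEndo (β x) (leviCivita Y x) := by
  ext v
  have hinterior : extD (interiorProd Y β) x v
      = ∑ i : Fin (p + 1), (-1 : ℝ) ^ (i : ℕ)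
          * covForm β x (v i) (Matrix.vecCons (Y x) (i.removeNth v))
        + insertEndo (β x) (leviCivita Y x) v := by
    rw [extD_apply_eq_sum_covForm, insertEndo_eq_sum_vecCons_removeNth, ← Finset.sum_add_distrib]
    refine Finset.sum_congr rfl fun i _ => ?_
    rw [covForm_interiorProd hβ hY, ← mul_add]
    rfl
  have hremove : ∀ i : Fin (p + 1), i.succ.removeNth (Matrix.vecCons (Y x) v)
      = Matrix.vecCons (Y x) (i.removeNth v) := fun i =>
    funext <| Fin.cases rfl fun j => congrArg (Matrix.vecCons (Y x) v) (Fin.succ_succAbove_succ i j)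
  have hexterior : extD β x (Matrix.vecCons (Y x) v)
      = covForm β x (Y x) v - ∑ i : Fin (p + 1), (-1 : ℝ) ^ (i : ℕ)
          * covForm β x (v i) (Matrix.vecCons (Y x) (i.removeNth v)) := by
    rw [extD_apply_eq_sum_covForm, Fin.sum_univ_succ, sub_eq_add_neg, ← Finset.sum_neg_distrib]
    simp only [hremove, Matrix.cons_val_succ, Fin.val_succ, pow_succ]
    simp
  rw [ContinuousAlternatingMap.add_apply, hinterior,
    ContinuousAlternatingMap.curryLeft_apply_apply, hexterior, ContinuousAlternatingMap.add_apply]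
  ring

theorem extD_flat_apply {Y : VField n M} (hY : SmoothField Y) (x : M)
    (v : Fin 2 → TangentSpace (𝓡 n) x) :
    extD (flat Y) x v
      = inner ℝ (leviCivita Y x (v 0)) (v 1) - inner ℝ (leviCivita Y x (v 1)) (v 0) := by
  rw [extD_apply_eq_sum_covForm, Fin.sum_univ_two, covForm_flat_apply hY, covForm_flat_apply hY]
  simp [Fin.removeNth, sub_eq_add_neg]

theorem insertEndo_flat_symGrad_of_interiorProd_eq_zero {Y Z : VField n M} (hY : SmoothField Y)
    (hZ : interiorProd Z (extD (flat Y)) = 0) (x : M) :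
    insertEndo (flat Z x) (symGrad Y x) = flat (fun x => leviCivita Y x (Z x)) x := by
  ext v
  have hrotation : extD (flat Y) x (Matrix.vecCons (Z x) v) = 0 :=
    (interiorProd_apply Z (extD (flat Y)) x v).symm.trans (by rw [hZ]; rfl)
  have hsymm : inner ℝ (leviCivita Y x (Z x)) (v 0) = inner ℝ (leviCivita Y x (v 0)) (Z x) :=
    sub_eq_zero.1 ((extD_flat_apply hY x (Matrix.vecCons (Z x) v)).symm.trans hrotation)
  have hflat : flat (fun x => leviCivita Y x (Z x)) x v = inner ℝ (leviCivita Y x (Z x)) (v 0) :=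
    flat_apply _ x v
  have hinsert := insertEndo_flat_symGrad Y Z x v
  rw [real_inner_comm, ← hsymm, ← two_mul, inv_mul_cancel_left₀ two_ne_zero] at hinsert
  exact hinsert.trans hflat.symm

theorem flat_leviCivita_self {Y : VField n M} (hY : SmoothField Y) :
    flat (fun x => leviCivita Y x (Y x))
      = interiorProd Y (extD (flat Y)) + (2⁻¹ : ℝ) • extD (interiorProd Y (flat Y)) := by
  funext x
  ext v
  have hkinetic : extD (interiorProd Y (flat Y)) x v
      = 2 * inner ℝ (leviCivita Y x (v 0)) (Y x) := by
    have hcov : covForm (flat Y) x (v 0) (Matrix.vecCons (Y x) (Fin.removeNth 0 v))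
        = inner ℝ (leviCivita Y x (v 0)) (Y x) := covForm_flat_apply hY x _ _
    have hflat : flat Y x (Matrix.vecCons (leviCivita Y x (v 0)) (Fin.removeNth 0 v))
        = inner ℝ (leviCivita Y x (v 0)) (Y x) :=
      (flat_apply Y x _).trans (real_inner_comm _ _)
    rw [extD_apply_eq_sum_covForm, Fin.sum_univ_one, covForm_interiorProd hY.flat hY,
      ContinuousAlternatingMap.add_apply, ContinuousAlternatingMap.curryLeft_apply_apply,
      ContinuousAlternatingMap.curryLeft_apply_apply, hcov, hflat]
    simp [two_mul]
  have hrotation : interiorProd Y (extD (flat Y)) x v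
      = inner ℝ (leviCivita Y x (Y x)) (v 0) - inner ℝ (leviCivita Y x (v 0)) (Y x) :=
    (interiorProd_apply Y _ x v).trans (extD_flat_apply hY x _)
  rw [Pi.add_apply, Pi.smul_apply, ContinuousAlternatingMap.add_apply,
    ContinuousAlternatingMap.smul_apply, hkinetic, hrotation, flat_apply, smul_eq_mul]
  ring

end Cartan

theorem extD_interiorProd_interiorProd_volForm {q : ℕ} {M : Type*} [TopologicalSpace M]
    [ChartedSpace (EuclideanSpace ℝ (Fin (q + 2))) M]
    [IsManifold (𝓡 (q + 2)) ∞ M] [RiemannianBundle (fun x : M => TangentSpace (𝓡 (q + 2)) x)]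
    [IsContMDiffRiemannianBundle (𝓡 (q + 2)) ∞ (EuclideanSpace ℝ (Fin (q + 2)))
      (fun x : M => TangentSpace (𝓡 (q + 2)) x)] (o : MOrientation (q + 2) M)
    {Y Z : VField (q + 2) M} (hY : SmoothField Y) (hZ : SmoothField Z)
    (hY_div : ∀ x, div Y x = 0) (hZ_closed : extD (interiorProd Z (volForm o)) = 0) :
    extD (interiorProd Y (interiorProd Z (volForm o)))
      = interiorProd (fun x => leviCivita Z x (Y x) - leviCivita Y x (Z x)) (volForm o) := by
  funext x
  have hdiv : LinearMap.trace ℝ _ (leviCivita Y x).toLinearMap = 0 := hY_div x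
  have hcov : covForm (interiorProd Z (volForm o)) x (Y x)
      = (volForm o x).curryLeft (leviCivita Z x (Y x)) := by
    rw [covForm_interiorProd (smoothForm_volForm o) hZ, covForm_volForm]
    exact zero_add _
  have hinsert : insertEndo (interiorProd Z (volForm o) x) (leviCivita Y x)
      = - (volForm o x).curryLeft (leviCivita Y x (Z x)) := by
    refine (insertEndo_curryLeft Fact.out (volForm o x) (leviCivita Y x) (Z x)).trans ?_
    rw [hdiv, zero_smul, zero_sub]
  have hcartan := extD_interiorProd_add ((smoothForm_volForm o).interiorProd hZ) hY x
  have hclosed : (extD (interiorProd Z (volForm o)) x).curryLeft (Y x) = 0 := by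
    rw [hZ_closed]
    rfl
  rw [hclosed, add_zero, hcov, hinsert, ← sub_eq_add_neg] at hcartan
  exact hcartan.trans (map_sub (volForm o x).curryLeft _ _).symm

section Advection

variable {M : Type*} [TopologicalSpace M] [ChartedSpace (EuclideanSpace ℝ (Fin 3)) M]
  [IsManifold (𝓡 3) ∞ M] [RiemannianBundle (fun x : M => TangentSpace (𝓡 3) x)]

theorem interiorProd_sharpField_vorticity (o : MOrientation 3 M) (u : VField 3 M) :
    interiorProd (sharpField (vorticity o u)) (volForm o) = extD (flat u) :=
  interiorProd_sharpField_star o rfl (extD (flat u))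

variable [IsContMDiffRiemannianBundle (𝓡 3) ∞ (EuclideanSpace ℝ (Fin 3))
      (fun x : M => TangentSpace (𝓡 3) x)]

theorem SmoothForm.vorticity (o : MOrientation 3 M) {u : VField 3 M} (hu : SmoothField u) :
    SmoothForm (vorticity o u) :=
  hu.flat.extD.star o rfl

theorem vorticity_advection (o : MOrientation 3 M) {u : VField 3 M} (hu : SmoothField u)
    (hu_div : ∀ x, div u x = 0) :
    vorticity o (fun x => leviCivita u x (u x))
      = flat (fun x => leviCivita (sharpField (vorticity o u)) x (u x)
          - leviCivita u x (sharpField (vorticity o u) x)) := by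
  have hW := (SmoothForm.vorticity o hu).sharpField
  have hW_closed : extD (interiorProd (sharpField (vorticity o u)) (volForm o)) = 0 := by
    rw [interiorProd_sharpField_vorticity, extD_extD hu.flat]
  rw [vorticity, flat_leviCivita_self hu, extD_add (hu.flat.extD.interiorProd hu)
    ((hu.flat.interiorProd hu).extD.smul _), extD_smul, extD_extD (hu.flat.interiorProd hu),
    smul_zero, add_zero, ← interiorProd_sharpField_vorticity o u,
    extD_interiorProd_interiorProd_volForm o hu hW hu_div hW_closed, star_interiorProd_volForm]

theorem insertEndo_vorticity_symGrad (o : MOrientation 3 M) {u : VField 3 M} (hu : SmoothField u)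
    (x : M) :
    insertEndo (vorticity o u x) (symGrad u x)
      = flat (fun x => leviCivita u x (sharpField (vorticity o u) x)) x := by
  have hdu : interiorProd (sharpField (vorticity o u)) (extD (flat u)) = 0 := by
    rw [← interiorProd_sharpField_vorticity o u, interiorProd_interiorProd_self]
  have hinsert := insertEndo_flat_symGrad_of_interiorProd_eq_zero hu hdu x
  rwa [flat_sharpField] at hinsert

theorem vorticity_advection_apply (o : MOrientation 3 M) {u : VField 3 M} (hu : SmoothField u)
    (hu_div : ∀ x, div u x = 0) (x : M) :
    vorticity o (fun x => leviCivita u x (u x)) x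
      = covForm (vorticity o u) x (u x) - insertEndo (vorticity o u x) (symGrad u x) := by
  have hW := (SmoothForm.vorticity o hu).sharpField
  rw [vorticity_advection o hu hu_div, insertEndo_vorticity_symGrad o hu]
  ext v
  have hcov := covForm_flat_apply hW x (u x) v
  rw [flat_sharpField] at hcov
  rw [ContinuousAlternatingMap.sub_apply, hcov, flat_apply, flat_apply, inner_sub_left]

end Advection

section Pressure

variable {n : ℕ} {M : Type*} [TopologicalSpace M] [ChartedSpace (EuclideanSpace ℝ (Fin n)) M]

variable (n) in
/-- A function regarded as a `0`-form, so that its differential is an exterior derivative. -/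
def functionForm (f : M → ℝ) : DForm n M 0 := fun x =>
  ContinuousAlternatingMap.constOfIsEmpty ℝ (TangentSpace (𝓡 n) x) (Fin 0) (f x)

variable [IsManifold (𝓡 n) ∞ M]

theorem smoothForm_functionForm {f : M → ℝ} (hf : ContMDiff (𝓡 n) 𝓘(ℝ, ℝ) ∞ f) :
    SmoothForm (functionForm n f) := fun x =>
  contDiffOn_alternating_iff.2 fun _ =>
    contMDiffOn_iff_contDiffOn.1 (hf.comp_contMDiffOn (contMDiffOn_extChartAt_symm x))

theorem mfderiv_eq_fderiv_comp_toModel {f : M → ℝ} {x : M}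
    (hf : DifferentiableAt ℝ (fun z => f ((extChartAt (𝓡 n) x).symm z)) (extChartAt (𝓡 n) x x)) :
    mfderiv (𝓡 n) 𝓘(ℝ, ℝ) f x
      = fderiv ℝ (fun z => f ((extChartAt (𝓡 n) x).symm z)) (extChartAt (𝓡 n) x x)
          ∘L toModel x x := by
  have hchart : HasMFDerivAt (𝓡 n) 𝓘(ℝ, Model n) (extChartAt (𝓡 n) x) x (toModel x x) :=
    (mdifferentiableAt_extChartAt (mem_chart_source _ x)).hasMFDerivAt
  refine ((hf.hasFDerivAt.hasMFDerivAt.comp x hchart).congr_of_eventuallyEq ?_).mfderiv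
  filter_upwards [extChartAt_source_mem_nhds (I := 𝓡 n) x] with y hy
  exact congrArg f ((extChartAt (𝓡 n) x).left_inv hy).symm

variable [RiemannianBundle (fun x : M => TangentSpace (𝓡 n) x)]

theorem flat_grad {f : M → ℝ} (hf : ContMDiff (𝓡 n) 𝓘(ℝ, ℝ) ∞ f) :
    flat (grad f) = extD (functionForm n f) := by
  funext x
  ext v
  have hdiff : DifferentiableAt ℝ (formInChart (functionForm n f) x) (extChartAt (𝓡 n) x x) :=
    (smoothForm_functionForm hf).differentiableAt x
  have hinner : inner ℝ (grad f x) (v 0) = mfderiv (𝓡 n) 𝓘(ℝ, ℝ) f x (v 0) := inner_sharp _ _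
  have hmfderiv := DFunLike.congr_fun
    (mfderiv_eq_fderiv_comp_toModel (hdiff.continuousAlternatingMap_apply_const ![])) (v 0)
  have hextD : extD (functionForm n f) x v
      = fderiv ℝ (fun z => f ((extChartAt (𝓡 n) x).symm z)) (extChartAt (𝓡 n) x x)
          (toModel x x (v 0)) := by
    have hchart : formInChart (functionForm n f) x = fun z =>
        ContinuousAlternatingMap.constOfIsEmpty ℝ (Model n) (Fin 0)
          (f ((extChartAt (𝓡 n) x).symm z)) := rfl
    rw [extD, hchart, extDeriv_constOfIsEmpty]
    rfl
  rw [flat_apply, hinner, hextD]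
  exact hmfderiv

end Pressure

theorem vorticity_grad {M : Type*} [TopologicalSpace M] [ChartedSpace (EuclideanSpace ℝ (Fin 3)) M]
    [IsManifold (𝓡 3) ∞ M] [RiemannianBundle (fun x : M => TangentSpace (𝓡 3) x)]
    (o : MOrientation 3 M) {f : M → ℝ} (hf : ContMDiff (𝓡 3) 𝓘(ℝ, ℝ) ∞ f) :
    vorticity o (grad f) = 0 := by
  rw [vorticity, flat_grad hf, extD_extD (smoothForm_functionForm hf), star_zero]

section MixedDerivatives

variable {E F : Type*} [NormedAddCommGroup E] [NormedSpace ℝ E] [NormedAddCommGroup F]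
  [NormedSpace ℝ F] {J : Set ℝ} {U : Set E} {f : ℝ × E → F} {f' : ℝ × E →L[ℝ] F} {t : ℝ} {z : E}

theorem hasFDerivAt_prodMk_right_comp (hU : IsOpen U)
    (hf : HasFDerivWithinAt f f' (J ×ˢ U) (t, z)) (ht : t ∈ J) (hz : z ∈ U) :
    HasFDerivAt (fun y => f (t, y)) (f' ∘L ContinuousLinearMap.inr ℝ ℝ E) z :=
  (hf.comp z (hasFDerivAt_prodMk_right t z).hasFDerivWithinAt fun _ hy => ⟨ht, hy⟩).hasFDerivAt
    (hU.mem_nhds hz)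

theorem hasDerivWithinAt_prodMk_left_comp (hf : HasFDerivWithinAt f f' (J ×ˢ U) (t, z))
    (hz : z ∈ U) : HasDerivWithinAt (fun s => f (s, z)) (f' (1, 0)) J t :=
  hf.comp_hasDerivWithinAt t
    ((hasDerivWithinAt_id t J).prodMk (hasDerivWithinAt_const t J z))
    fun _ hs => Set.mk_mem_prod hs hz

theorem hasDerivWithinAt_fderiv_of_contDiffOn (hJ : UniqueDiffOn ℝ J) (hU : IsOpen U)
    (hf : ContDiffOn ℝ 2 f (J ×ˢ U)) (ht : t ∈ J) (ht' : t ∈ closure (interior J)) (hz : z ∈ U) :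
    HasDerivWithinAt (fun s => fderiv ℝ (fun y => f (s, y)) z)
      (fderiv ℝ (fun y => derivWithin (fun s => f (s, y)) J t) z) J t := by
  have hJU : UniqueDiffOn ℝ (J ×ˢ U) := hJ.prod hU.uniqueDiffOn
  let f' := fderivWithin ℝ f (J ×ˢ U)
  let f'' := fderivWithin ℝ f' (J ×ˢ U) (t, z)
  have hf' : ∀ q ∈ J ×ˢ U, HasFDerivWithinAt f (f' q) (J ×ˢ U) q := fun q hq =>
    (hf.differentiableOn two_ne_zero q hq).hasFDerivWithinAt
  have hf'' : HasFDerivWithinAt f' f'' (J ×ˢ U) (t, z) :=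
    ((hf.fderivWithin hJU (m := 1) one_add_one_eq_two.le).differentiableOn one_ne_zero
      (t, z) ⟨ht, hz⟩).hasFDerivWithinAt
  have hspace : ∀ s ∈ J, fderiv ℝ (fun y => f (s, y)) z
      = f' (s, z) ∘L ContinuousLinearMap.inr ℝ ℝ E := fun s hs =>
    (hasFDerivAt_prodMk_right_comp hU (hf' (s, z) ⟨hs, hz⟩) hs hz).fderiv
  have htime : ∀ y ∈ U, derivWithin (fun s => f (s, y)) J t = f' (t, y) (1, 0) := fun y hy =>
    (hasDerivWithinAt_prodMk_left_comp (hf' (t, y) ⟨ht, hy⟩) hy).derivWithin (hJ t ht)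
  have htime_space : HasDerivWithinAt (fun s => fderiv ℝ (fun y => f (s, y)) z)
      (f'' (1, 0) ∘L ContinuousLinearMap.inr ℝ ℝ E) J t :=
    (((ContinuousLinearMap.compL ℝ E (ℝ × E) F).flip
      (ContinuousLinearMap.inr ℝ ℝ E)).hasFDerivAt.comp_hasDerivWithinAt t
        (hasDerivWithinAt_prodMk_left_comp hf'' hz)).congr hspace (hspace t ht)
  have hspace_time : HasFDerivAt (fun y => derivWithin (fun s => f (s, y)) J t)
      (f''.flip (1, 0) ∘L ContinuousLinearMap.inr ℝ ℝ E) z :=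
    ((ContinuousLinearMap.apply ℝ F ((1, 0) : ℝ × E)).hasFDerivAt.comp z
      (hasFDerivAt_prodMk_right_comp hU hf'' ht hz)).congr_of_eventuallyEq
        (Filter.eventuallyEq_of_mem (hU.mem_nhds hz) htime)
  have hclosure : (t, z) ∈ closure (interior (J ×ˢ U)) := by
    rw [interior_prod_eq, closure_prod_eq, hU.interior_eq]
    exact ⟨ht', subset_closure hz⟩
  have hsymm := (hf (t, z) ⟨ht, hz⟩).isSymmSndFDerivWithinAt minSmoothness_of_isRCLikeNormedField.le
    hJU hclosure ⟨ht, hz⟩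
  rw [hspace_time.fderiv]
  exact htime_space.congr_deriv (ContinuousLinearMap.ext fun h => hsymm.eq (1, 0) (0, h))

end MixedDerivatives

section TopologicalVectorSpaces

variable {E F : Type*} [AddCommGroup E] [Module ℝ E] [TopologicalSpace E] [ContinuousSMul ℝ E]
  [AddCommGroup F] [Module ℝ F] [TopologicalSpace F] [ContinuousSMul ℝ F] {f : ℝ → E} {f' : E}
  {s : Set ℝ} {t : ℝ}

theorem hasDerivWithinAt_clm_comp (L : E →L[ℝ] F) (hf : HasDerivWithinAt f f' s t) :
    HasDerivWithinAt (fun r => L (f r)) (L f') s t := by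
  refine .of_isLittleOTVS ((L.isBigOTVS_comp.trans_isLittleOTVS hf.isLittleOTVS).congr_left ?_)
  intro q
  simp

theorem derivWithin_eq_of_hasDerivWithinAt [ContinuousAdd E] [T2Space E]
    (hf : HasDerivWithinAt f f' s t) (hs : UniqueDiffWithinAt ℝ s t) : derivWithin f s t = f' := by
  rw [derivWithin, hf.hasFDerivWithinAt.fderivWithin hs, ContinuousLinearMap.toSpanSingleton_apply,
    one_smul]

end TopologicalVectorSpaces

section TimeDependentFields

variable {n : ℕ} {M : Type*} [TopologicalSpace M] [ChartedSpace (EuclideanSpace ℝ (Fin n)) M]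

/-- Joint smoothness in time and space of a time-dependent vector field, tested in every preferred
chart; as for `SmoothField`, this is the form in which smoothness is used for computations. -/
def SmoothTimeField (J : Set ℝ) (u : ℝ → VField n M) : Prop :=
  ∀ x : M, ContDiffOn ℝ ∞ (fun q : ℝ × Model n => fieldInChart (u q.1) x q.2)
    (J ×ˢ (extChartAt (𝓡 n) x).target)

variable {J : Set ℝ} {u : ℝ → VField n M} {t : ℝ}

theorem SmoothTimeField.smoothField (hu : SmoothTimeField J u) (ht : t ∈ J) : SmoothField (u t) :=
  fun x => (hu x).comp (contDiff_prodMk_right t).contDiffOn fun _ hz => ⟨ht, hz⟩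

variable [IsManifold (𝓡 n) ∞ M]

theorem smoothTimeField_of_contMDiffOn
    (hu : ContMDiffOn (𝓘(ℝ, ℝ).prod (𝓡 n)) (𝓡 n).tangent ∞
      (fun z : ℝ × M =>
        (⟨z.2, u z.1 z.2⟩ : TotalSpace (Model n) (TangentSpace (𝓡 n) : M → Type _)))
      (J ×ˢ Set.univ)) : SmoothTimeField J u := by
  intro x
  have hsource := hu.mono (Set.prod_mono_right (Set.subset_univ (extChartAt (𝓡 n) x).source))
  have hfield := ((contMDiffOn_fieldAlong_iff x fun _ hq => hq.2).1 hsource).2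
  have hchart : ContMDiffOn (𝓘(ℝ, ℝ).prod 𝓘(ℝ, Model n)) (𝓘(ℝ, ℝ).prod (𝓡 n)) ∞
      (fun q : ℝ × Model n => (q.1, (extChartAt (𝓡 n) x).symm q.2))
      (J ×ˢ (extChartAt (𝓡 n) x).target) :=
    contMDiffOn_fst.prodMk
      ((contMDiffOn_extChartAt_symm x).comp contMDiffOn_snd fun _ hq => hq.2)
  rw [← contMDiffOn_iff_contDiffOn, modelWithCornersSelf_prod, ← chartedSpaceSelf_prod]
  exact hfield.comp hchart fun _ hq => ⟨hq.1, (extChartAt (𝓡 n) x).map_target hq.2⟩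

variable [RiemannianBundle (fun x : M => TangentSpace (𝓡 n) x)]

theorem SmoothTimeField.hasDerivWithinAt_fieldInChart (hu : SmoothTimeField J u) (ht : t ∈ J)
    (x : M) {z : Model n} (hz : z ∈ (extChartAt (𝓡 n) x).target) :
    HasDerivWithinAt (fun s => fieldInChart (u s) x z)
      (fieldInChart (fun y => derivWithin (fun s => u s y) J t) x z) J t := by
  let y := (extChartAt (𝓡 n) x).symm z
  have hchart : DifferentiableWithinAt ℝ (fun s => fieldInChart (u s) x z) J t :=
    ((hu x).comp (contDiff_prodMk_left z).contDiffOn fun _ hs => ⟨hs, hz⟩).differentiableOn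
      (by simp) t ht
  have hfield : DifferentiableWithinAt ℝ (fun s => u s y) J t :=
    ((ofModel x z).differentiableAt.comp_differentiableWithinAt t hchart).congr
      (fun s _ => (ofModel_toModel x hz (u s y)).symm) (ofModel_toModel x hz (u t y)).symm
  exact (toModel x y).hasFDerivAt.comp_hasDerivWithinAt t hfield.hasDerivWithinAt

theorem formInChart_flat_eq_ofSubsingletonLIE (Y : VField n M) (x : M) {z : Model n}
    (hz : z ∈ (extChartAt (𝓡 n) x).target) :
    formInChart (flat Y) x z = ContinuousAlternatingMap.ofSubsingletonLIE (0 : Fin 1)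
      (metricInChart x z (fieldInChart Y x z)) :=
  ContinuousAlternatingMap.ext (formInChart_flat Y x hz)

theorem SmoothTimeField.hasDerivWithinAt_formInChart_flat (hu : SmoothTimeField J u) (ht : t ∈ J)
    (x : M) {z : Model n} (hz : z ∈ (extChartAt (𝓡 n) x).target) :
    HasDerivWithinAt (fun s => formInChart (flat (u s)) x z)
      (formInChart (flat fun y => derivWithin (fun s => u s y) J t) x z) J t := by
  let ofCovector := (ContinuousAlternatingMap.ofSubsingletonLIE (𝕜 := ℝ) (E := Model n) (F := ℝ)
    (0 : Fin 1)).toContinuousLinearEquiv.toContinuousLinearMap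
  simp only [formInChart_flat_eq_ofSubsingletonLIE _ x hz]
  exact (ofCovector ∘L metricInChart x z).hasFDerivAt.comp_hasDerivWithinAt t
    (hu.hasDerivWithinAt_fieldInChart ht x hz)

variable [IsContMDiffRiemannianBundle (𝓡 n) ∞ (EuclideanSpace ℝ (Fin n))
      (fun x : M => TangentSpace (𝓡 n) x)]

theorem SmoothTimeField.contDiffOn_formInChart_flat (hu : SmoothTimeField J u) (x : M) :
    ContDiffOn ℝ ∞ (fun q : ℝ × Model n => formInChart (flat (u q.1)) x q.2)
      (J ×ˢ (extChartAt (𝓡 n) x).target) :=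
  have hmetric : ContDiffOn ℝ ∞ (fun q : ℝ × Model n => metricInChart x q.2)
      (J ×ˢ (extChartAt (𝓡 n) x).target) :=
    (contDiffOn_metricInChart x).comp contDiff_snd.contDiffOn fun _ hq => hq.2
  contDiffOn_alternating_iff.2 fun v =>
    ((hmetric.clm_apply (hu x)).clm_apply contDiffOn_const).congr
      fun q hq => formInChart_flat (u q.1) x hq.2 v

theorem SmoothTimeField.hasDerivWithinAt_extDeriv_formInChart_flat (hu : SmoothTimeField J u)
    (hJ : UniqueDiffOn ℝ J) (ht : t ∈ J) (ht' : t ∈ closure (interior J)) (x : M) :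
    HasDerivWithinAt (fun s => extDeriv (formInChart (flat (u s)) x) (extChartAt (𝓡 n) x x))
      (extDeriv (formInChart (flat fun y => derivWithin (fun s => u s y) J t) x)
        (extChartAt (𝓡 n) x x)) J t := by
  have hderiv : (fun z => derivWithin (fun s => formInChart (flat (u s)) x z) J t)
      =ᶠ[𝓝 (extChartAt (𝓡 n) x x)]
        formInChart (flat fun y => derivWithin (fun s => u s y) J t) x :=
    Filter.eventuallyEq_of_mem (extChartAt_target_mem_nhds x) fun z hz =>
      (hu.hasDerivWithinAt_formInChart_flat ht x hz).derivWithin (hJ t ht)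
  have hfderiv := hasDerivWithinAt_fderiv_of_contDiffOn hJ (isOpen_target x)
    ((hu.contDiffOn_formInChart_flat x).of_le (by norm_cast)) ht ht'
    (mem_extChartAt_target x)
  rw [hderiv.fderiv_eq] at hfderiv
  exact (ContinuousAlternatingMap.alternatizeUncurryFinCLM ℝ (Model n) ℝ
    (n := 1)).hasFDerivAt.comp_hasDerivWithinAt t hfderiv

theorem SmoothTimeField.hasDerivWithinAt_extD_flat (hu : SmoothTimeField J u)
    (hJ : UniqueDiffOn ℝ J) (ht : t ∈ J) (ht' : t ∈ closure (interior J)) (x : M) :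
    HasDerivWithinAt (fun s => extD (flat (u s)) x)
      (extD (flat fun y => derivWithin (fun s => u s y) J t) x) J t :=
  hasDerivWithinAt_clm_comp (ContinuousAlternatingMap.compContinuousLinearMapCLM (toModel x x))
    (hu.hasDerivWithinAt_extDeriv_formInChart_flat hJ ht ht' x)

end TimeDependentFields

theorem hasDerivWithinAt_star {n p q : ℕ} {M : Type*} [TopologicalSpace M]
    [ChartedSpace (EuclideanSpace ℝ (Fin n)) M] [IsManifold (𝓡 n) ∞ M]
    [RiemannianBundle (fun x : M => TangentSpace (𝓡 n) x)] (o : MOrientation n M) (h : p + q = n)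
    {α : ℝ → DForm n M p} {α' : DForm n M p} {J : Set ℝ} {t : ℝ} {x : M}
    (hα : HasDerivWithinAt (fun s => α s x) (α' x) J t) :
    HasDerivWithinAt (fun s => star o h (α s) x) (star o h α' x) J t := by
  let e := stdOrthonormalBasis ℝ (TangentSpace (𝓡 n) x)
  let starAt : (TangentSpace (𝓡 n) x [⋀^Fin p]→L[ℝ] ℝ) →L[ℝ]
      TangentSpace (𝓡 n) x [⋀^Fin q]→L[ℝ] ℝ :=
    (p.factorial : ℝ)⁻¹ • ∑ f : Fin p → Fin (finrank ℝ (TangentSpace (𝓡 n) x)),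
      (ContinuousAlternatingMap.apply ℝ (TangentSpace (𝓡 n) x) ℝ fun i => e (f i)).smulRight
        (contractVol (o.orient x) h fun i => e (f i))
  have hstar : ∀ β : DForm n M p, star o h β x = starAt (β x) := fun β => by
    simp [starAt, star, hodgeStar, e]
  simpa only [hstar] using hasDerivWithinAt_clm_comp starAt hα

theorem mem_closure_interior_of_ordConnected {J : Set ℝ} {t : ℝ} (hJ : J.OrdConnected)
    (hJ' : J.Nontrivial) (ht : t ∈ J) : t ∈ closure (interior J) := by
  rw [(hJ.convex (𝕜 := ℝ)).closure_interior_eq_closure_of_nonempty_interior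
    (hJ.convex.nontrivial_iff_nonempty_interior.1 hJ')]
  exact subset_closure ht

theorem uniqueDiffOn_of_ordConnected {J : Set ℝ} (hJ : J.OrdConnected) (hJ' : J.Nontrivial) :
    UniqueDiffOn ℝ J :=
  uniqueDiffOn_convex hJ.convex (hJ.convex.nontrivial_iff_nonempty_interior.1 hJ')

section VorticityEquation

variable {M : Type*} [TopologicalSpace M] [ChartedSpace (EuclideanSpace ℝ (Fin 3)) M]
  [IsManifold (𝓡 3) ∞ M] [RiemannianBundle (fun x : M => TangentSpace (𝓡 3) x)]

theorem vorticity_smul (o : MOrientation 3 M) (c : ℝ) (Y : VField 3 M) :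
    vorticity o (c • Y) = c • vorticity o Y := by
  rw [vorticity, flat_smul, extD_smul, star_smul, vorticity]

theorem vorticity_add (o : MOrientation 3 M) {Y Z : VField 3 M} (hY : SmoothForm (flat Y))
    (hZ : SmoothForm (flat Z)) : vorticity o (Y + Z) = vorticity o Y + vorticity o Z := by
  rw [vorticity, flat_add, extD_add hY hZ, star_add, vorticity, vorticity]

variable {o : MOrientation 3 M} {ν : ℝ} {J : Set ℝ} {u : ℝ → VField 3 M} {p : ℝ → M → ℝ} {t : ℝ}

theorem IsSmoothNSSolution.derivWithin_velocity (hu : IsSmoothNSSolution o ν J u p) (ht : t ∈ J) :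
    (fun x => derivWithin (fun s => u s x) J t)
      = (-1 : ℝ) • (grad (p t)
        + ((fun x => leviCivita (u t) x (u t x)) + ν • laplacianField o (u t))) := by
  funext x
  simp only [Pi.smul_apply, Pi.add_apply, smul_add, neg_one_smul, ← hu.momentum t ht x]
  abel

variable [IsContMDiffRiemannianBundle (𝓡 3) ∞ (EuclideanSpace ℝ (Fin 3))
      (fun x : M => TangentSpace (𝓡 3) x)]

theorem vorticity_laplacianField (o : MOrientation 3 M) {Y : VField 3 M} (hY : SmoothField Y) :
    vorticity o (laplacianField o Y) = laplacianForm o (vorticity o Y) := by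
  rw [vorticity, laplacianField, flat_sharpField, vorticity, laplacianForm_star_extD hY.flat]

theorem SmoothTimeField.hasDerivWithinAt_vorticity (o : MOrientation 3 M)
    (hu : SmoothTimeField J u) (hJ : UniqueDiffOn ℝ J) (ht : t ∈ J)
    (ht' : t ∈ closure (interior J)) (x : M) :
    HasDerivWithinAt (fun s => vorticity o (u s) x)
      (vorticity o (fun y => derivWithin (fun s => u s y) J t) x) J t :=
  hasDerivWithinAt_star o rfl (hu.hasDerivWithinAt_extD_flat hJ ht ht' x)

theorem IsSmoothNSSolution.vorticity_derivWithin_velocity (hu : IsSmoothNSSolution o ν J u p)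
    (ht : t ∈ J) :
    vorticity o (fun x => derivWithin (fun s => u s x) J t)
      = -(vorticity o (fun x => leviCivita (u t) x (u t x))
        + ν • laplacianForm o (vorticity o (u t))) := by
  have hut := (smoothTimeField_of_contMDiffOn hu.smooth_velocity).smoothField ht
  have hgrad : SmoothForm (flat (grad (n := 3) (p t))) := by
    rw [flat_grad (hu.smooth_pressure t ht)]
    exact (smoothForm_functionForm (hu.smooth_pressure t ht)).extD
  have hadvection : SmoothForm (flat fun x => leviCivita (u t) x (u t x)) := by
    rw [flat_leviCivita_self hut]
    exact (hut.flat.extD.interiorProd hut).add ((hut.flat.interiorProd hut).extD.smul _)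
  have hdiffusion : SmoothForm (flat (ν • laplacianField o (u t))) := by
    rw [flat_smul, laplacianField, flat_sharpField]
    exact (hut.flat.hodgeLaplacian o rfl).smul ν
  have hforces : SmoothForm (flat ((fun x => leviCivita (u t) x (u t x))
      + ν • laplacianField o (u t))) := by
    rw [flat_add]
    exact hadvection.add hdiffusion
  rw [hu.derivWithin_velocity ht, vorticity_smul, vorticity_add o hgrad hforces,
    vorticity_grad o (hu.smooth_pressure t ht), zero_add, vorticity_add o hadvection hdiffusion,
    vorticity_smul, vorticity_laplacianField o hut]
  exact neg_one_smul ℝ (_ : DForm 3 M 1)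

end VorticityEquation

end

end NSVorticity

open NSVorticity

theorem mainTheorem10 {M : Type*} [TopologicalSpace M]
    [ChartedSpace (EuclideanSpace ℝ (Fin 3)) M] [IsManifold (𝓡 3) ∞ M]
    [RiemannianBundle (fun x : M => TangentSpace (𝓡 3) x)]
    [IsContMDiffRiemannianBundle (𝓡 3) ∞ (EuclideanSpace ℝ (Fin 3))
      (fun x : M => TangentSpace (𝓡 3) x)]
    (o : NSVorticity.MOrientation 3 M) (ν : ℝ)
    (J : Set ℝ) (hJ : J.OrdConnected) (hJ' : J.Nontrivial)
    (u : ℝ → NSVorticity.VField 3 M) (p : ℝ → M → ℝ)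
    (hu : NSVorticity.IsSmoothNSSolution o ν J u p) :
    ∀ t ∈ J, ∀ x : M,
      DifferentiableWithinAt ℝ (fun s => NSVorticity.vorticity o (u s) x) J t ∧
      derivWithin (fun s => NSVorticity.vorticity o (u s) x) J t
          + NSVorticity.covForm (NSVorticity.vorticity o (u t)) x (u t x)
          + ν • NSVorticity.laplacianForm o (NSVorticity.vorticity o (u t)) x
        = NSVorticity.insertEndo (NSVorticity.vorticity o (u t) x)
            (NSVorticity.symGrad (u t) x) := by
  intro t ht x
  have hu_smooth := smoothTimeField_of_contMDiffOn hu.smooth_velocity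
  have hJ_diff := uniqueDiffOn_of_ordConnected hJ hJ'
  have hderiv := hu_smooth.hasDerivWithinAt_vorticity o hJ_diff ht
    (mem_closure_interior_of_ordConnected hJ hJ' ht) x
  refine ⟨hderiv.hasFDerivWithinAt.differentiableWithinAt, ?_⟩
  rw [derivWithin_eq_of_hasDerivWithinAt hderiv (hJ_diff t ht),
    hu.vorticity_derivWithin_velocity ht, Pi.neg_apply, Pi.add_apply, Pi.smul_apply,
    vorticity_advection_apply o (hu_smooth.smoothField ht) (hu.incompressible t ht)]
  abel
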